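/- For every odd positive integer $k$ and every $\varepsilon>0$ there is a simple arrangement of $3k$ red and $2k$ blue lines in the Euclidean plane (no two lines are parallel, no point lies on more than two lines) in which every alternating dual path has length at most $14k$. Here a dual path is a sequence of pairwise distinct faces of the arrangement in which consecutive faces share an edge; it is alternating if no two consecutive shared edges lie on lines of the same color; and its length is the number of its faces. Moreover, the arrangement can be chosen as follows. The red lines are the extensions of the $3k$ sides of a regular $3k$-gon $P$. The $3k$ lines joining a vertex of $P$ to the midpoint of the opposite side divide the exterior of $P$ into $6k$ unbounded regions, called slabs; mark every third slab in cyclic order, so that the $2k$ marked slabs form $k$ opposite pairs. The blue lines form $k$ twin pairs, one for each pair of opposite marked slabs: the two twins make an angle less than $\varepsilon$, and outside $P$ each of them lies entirely within the two opposite marked slabs of its pair. -/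

import Mathlib

namespace LineArr

/-- The Euclidean plane. -/
abbrev Plane : Type := EuclideanSpace ℝ (Fin 2)

/-- A straight line in the plane. -/
def IsLine (l : AffineSubspace ℝ Plane) : Prop :=
  (l : Set Plane).Nonempty ∧ Module.finrank ℝ l.direction = 1

/-- The union of a set of lines. -/
def lineUnion (A : Set (AffineSubspace ℝ Plane)) : Set Plane := ⋃ l ∈ A, (l : Set Plane)

/-- The arrangement is simple: no two lines are parallel and every point of the plane lies on at
most two lines. -/
def IsSimple (A : Set (AffineSubspace ℝ Plane)) : Prop :=
  A.Pairwise (fun l m => ¬ l.Parallel m) ∧ ∀ p : Plane, {l | l ∈ A ∧ p ∈ l}.encard ≤ 2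

/-- A face: a connected component of the complement of the union of the lines. -/
def IsFace (A : Set (AffineSubspace ℝ Plane)) (f : Set Plane) : Prop :=
  ∃ p ∈ (lineUnion A)ᶜ, f = connectedComponentIn (lineUnion A)ᶜ p

/-- An edge on the line `l`: a connected component of `l` minus all other lines. -/
def IsEdge (A : Set (AffineSubspace ℝ Plane)) (l : AffineSubspace ℝ Plane) (e : Set Plane) :
    Prop :=
  ∃ p ∈ (l : Set Plane) \ lineUnion (A \ {l}),
    e = connectedComponentIn ((l : Set Plane) \ lineUnion (A \ {l})) p

/-- `f` and `g` share an edge lying on the line `l`. -/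
def ShareEdgeOn (A : Set (AffineSubspace ℝ Plane)) (l : AffineSubspace ℝ Plane)
    (f g : Set Plane) : Prop :=
  ∃ e, IsEdge A l e ∧ e ⊆ closure f ∧ e ⊆ closure g

/-- The type of faces of an arrangement. -/
def Face (A : Set (AffineSubspace ℝ Plane)) : Type := {f : Set Plane // IsFace A f}

/-- The dual graph: two distinct faces are adjacent when they share an edge. -/
def dualGraph (A : Set (AffineSubspace ℝ Plane)) : SimpleGraph (Face A) where
  Adj f g := f ≠ g ∧ ∃ l ∈ A, ShareEdgeOn A l f.1 g.1
  symm := ⟨fun _ _ h => ⟨h.1.symm, by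
    obtain ⟨l, hl, e, he, h1, h2⟩ := h.2
    exact ⟨l, hl, e, he, h2, h1⟩⟩⟩
  loopless := ⟨fun _ h => h.1 rfl⟩

/-- A bicolored line arrangement: a finite set of lines, each either red or blue, with both
colors present. -/
structure BicoloredArrangement where
  red : Finset (AffineSubspace ℝ Plane)
  blue : Finset (AffineSubspace ℝ Plane)
  isLine_red : ∀ l ∈ red, IsLine l
  isLine_blue : ∀ l ∈ blue, IsLine l
  disjoint : Disjoint red blue
  red_nonempty : red.Nonempty
  blue_nonempty : blue.Nonempty

namespace BicoloredArrangement

/-- All lines of the arrangement. -/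
def lines (A : BicoloredArrangement) : Set (AffineSubspace ℝ Plane) :=
  {l | l ∈ A.red ∨ l ∈ A.blue}

/-- The two faces share a red edge. -/
def RedContact (A : BicoloredArrangement) (f g : Face A.lines) : Prop :=
  ∃ l ∈ A.red, ShareEdgeOn A.lines l f.1 g.1

/-- The two faces share a blue edge. -/
def BlueContact (A : BicoloredArrangement) (f g : Face A.lines) : Prop :=
  ∃ l ∈ A.blue, ShareEdgeOn A.lines l f.1 g.1

/-- A walk in the dual graph is alternating if no two consecutive crossed edges have the same
color. -/
def IsAlternating (A : BicoloredArrangement) {f g : Face A.lines}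
    (p : (dualGraph A.lines).Walk f g) : Prop :=
  p.darts.IsChain (fun d d' =>
    ¬ (A.RedContact d.fst d.snd ∧ A.RedContact d'.fst d'.snd) ∧
    ¬ (A.BlueContact d.fst d.snd ∧ A.BlueContact d'.fst d'.snd))

end BicoloredArrangement

/-- The vertices of the regular `N`-gon inscribed in the unit circle. -/
noncomputable def polygonVertex (N i : ℕ) : Plane :=
  !₂[Real.cos (2 * Real.pi * i / N), Real.sin (2 * Real.pi * i / N)]

/-- The line extending the side between the vertices `i` and `i + 1`. -/
noncomputable def sideLine (N i : ℕ) : AffineSubspace ℝ Plane :=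
  line[ℝ, polygonVertex N i, polygonVertex N (i + 1)]

/-- The closed regular `N`-gon. -/
noncomputable def polygon (N : ℕ) : Set Plane := convexHull ℝ (Set.range (polygonVertex N))

/-- For odd `N`, the `N` axes of symmetry of the `N`-gon (each joining a vertex to the midpoint of
the opposite side) pass through the origin, in the directions of angle `m * π / N`. They cut the
exterior of the polygon into `2 * N` unbounded regions, the slabs; this is the `m`-th one. -/
noncomputable def slab (N m : ℕ) : Set Plane :=
  {p | ∃ r θ : ℝ, 0 < r ∧ m * Real.pi / N < θ ∧ θ < (m + 1) * Real.pi / N ∧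
    p = !₂[r * Real.cos θ, r * Real.sin θ]} \ polygon N

/-- The line lies, outside the polygon, inside two opposite marked slabs: every third slab
`0, 3, 6, …` is marked, and the slabs `m` and `m + N` are opposite. Here `N = 3 * k`. -/
def LiesInMarkedSlabs (k j : ℕ) (l : AffineSubspace ℝ Plane) : Prop :=
  (l : Set Plane) \ polygon (3 * k) ⊆ slab (3 * k) (3 * j) ∪ slab (3 * k) (3 * j + 3 * k)

/-- The angle between the two lines is less than `ε`. -/
def NearlyParallel (ε : ℝ) (l m : AffineSubspace ℝ Plane) : Prop :=
  ∃ u ∈ l.direction, ∃ v ∈ m.direction,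
    u ≠ 0 ∧ v ≠ 0 ∧ InnerProductGeometry.angle u v < ε

end LineArr

/-!
An alternating path crosses red and blue edges in turn, so it has at most `2 * m + 2` faces when it
crosses `m` blue edges, and it suffices to show `m ≤ 7 * k - 1`.

Put `N = 3 * k`. Give a point the *level* equal to the number of red lines separating it from the
polygon. Inside one slab the red lines do not cross, so slab and level together determine the
position with respect to all red lines (`sideDist_pos_iff_of_level_eq`); the level never exceeds
`(N + 1) / 2` (`level_le`). To a blue edge assign its *cell*: its level and, if the level is
positive, its marked slab. Three facts make the cells of the successive blue edges of the path into
a very restricted sequence.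

* Between two blue edges exactly one red line is crossed, so the level changes by one
  (`IsSlabArrangement.red_step`).
* If both levels are positive, the slab does not change. Otherwise three consecutive symmetry axes of
  the polygon would pass between the two edges. Each axis would preserve the set of red lines cutting
  off one edge or the set cutting off the other, so two axes would preserve the same set; their
  product is a rotation which generates all rotations because `N` is odd, and the set would be empty
  or consist of all red lines (`not_three_separating_axes`).
* No cell of positive level occurs twice, because two blue edges in one cell bound a common face,
  twins crossing only inside the polygon (`IsSlabArrangement.exists_common_face`).

Hence levels above one occur only in an initial and in a final run, of at most `(N - 1) / 2` edges
each; level one occurs at most `2 * k` times, once for each marked slab; and levels zero and one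
alternate in the middle. This gives the bound (`length_le_of_levels`).

For the construction the `2 * k` blue lines are tangents to one tiny circle about the centre, in
directions deviating slightly to both sides from the bisectors of the marked slabs. Three tangents to
a circle are never concurrent (`not_three_tangents`); this applies to the red lines too. Crossings of
two red lines lie on the symmetry axes and crossings of two blue lines close to the centre, so no
further incidences arise (`exists_isSlabArrangement`).
-/

namespace LineArr

open Real AffineSubspace

/-! ### Coordinates adapted to a direction -/

/-- The signed distance of `p` from the line through the origin with direction angle `φ`. -/
noncomputable def height (φ : ℝ) (p : Plane) : ℝ := cos φ * p 1 - sin φ * p 0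

/-- The signed length of the projection of `p` to the direction with angle `φ`. -/
noncomputable def along (φ : ℝ) (p : Plane) : ℝ := cos φ * p 0 + sin φ * p 1

lemma coord_zero (φ : ℝ) (p : Plane) : p 0 = cos φ * along φ p - sin φ * height φ p := by
  unfold along height; linear_combination (-p 0) * sin_sq_add_cos_sq φ

lemma coord_one (φ : ℝ) (p : Plane) : p 1 = sin φ * along φ p + cos φ * height φ p := by
  unfold along height; linear_combination (-p 1) * sin_sq_add_cos_sq φ

lemma plane_ext {p q : Plane} (h0 : p 0 = q 0) (h1 : p 1 = q 1) : p = q := by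
  ext i; fin_cases i <;> assumption

lemma eq_of_along_eq_of_height_eq {φ : ℝ} {p q : Plane} (ha : along φ p = along φ q)
    (hh : height φ p = height φ q) : p = q :=
  plane_ext (by rw [coord_zero φ p, coord_zero φ q, ha, hh])
    (by rw [coord_one φ p, coord_one φ q, ha, hh])

lemma along_sq_add_height_sq (φ : ℝ) (p : Plane) :
    along φ p ^ 2 + height φ p ^ 2 = p 0 ^ 2 + p 1 ^ 2 := by
  unfold along height; linear_combination (p 0 ^ 2 + p 1 ^ 2) * sin_sq_add_cos_sq φ

lemma height_sub_pi_div_two (φ : ℝ) (p : Plane) : height (φ - π / 2) p = along φ p := by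
  unfold along height; rw [cos_sub_pi_div_two, sin_sub_pi_div_two]; ring

lemma height_sub_height (a b : ℝ) (p : Plane) :
    height a p - height b p = -2 * sin ((a - b) / 2) * along ((a + b) / 2) p := by
  unfold along height
  linear_combination p 1 * cos_sub_cos a b - p 0 * sin_sub_sin a b

lemma along_sub_along (a b : ℝ) (p : Plane) :
    along a p - along b p = 2 * sin ((a - b) / 2) * height ((a + b) / 2) p := by
  unfold along height
  linear_combination p 0 * cos_sub_cos a b + p 1 * sin_sub_sin a b

lemma height_polar (φ r θ : ℝ) : height φ !₂[r * cos θ, r * sin θ] = r * sin (θ - φ) := by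
  rw [sin_sub]; simp [height]; ring

lemma along_polar (φ r θ : ℝ) : along φ !₂[r * cos θ, r * sin θ] = r * cos (θ - φ) := by
  rw [cos_sub]; simp [along]; ring

lemma height_lineMap (φ : ℝ) (x y : Plane) (t : ℝ) :
    height φ (AffineMap.lineMap x y t) = (1 - t) * height φ x + t * height φ y := by
  simp [height, AffineMap.lineMap_apply]; ring

lemma along_lineMap (φ : ℝ) (x y : Plane) (t : ℝ) :
    along φ (AffineMap.lineMap x y t) = (1 - t) * along φ x + t * along φ y := by
  rw [← height_sub_pi_div_two, height_lineMap, height_sub_pi_div_two, height_sub_pi_div_two]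

lemma continuous_height (φ : ℝ) : Continuous (height φ) := by
  unfold height; fun_prop

/-! ### Lines given by an equation -/

lemma mem_line_iff {φ c : ℝ} {x y : Plane} (hx : height φ x = c) (hy : height φ y = c)
    (hne : x ≠ y) (p : Plane) : p ∈ line[ℝ, x, y] ↔ height φ p = c := by
  rw [mem_affineSpan_pair_iff_exists_lineMap_eq]
  constructor
  · rintro ⟨t, rfl⟩
    rw [height_lineMap, hx, hy]; ring
  · intro hp
    have h : along φ y - along φ x ≠ 0 := fun h =>
      hne (eq_of_along_eq_of_height_eq (by linarith) (hx.trans hy.symm))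
    refine ⟨(along φ p - along φ x) / (along φ y - along φ x), ?_⟩
    apply eq_of_along_eq_of_height_eq (φ := φ)
    · rw [along_lineMap]; field_simp; ring
    · rw [height_lineMap, hx, hy, hp]; ring

lemma isLine_affineSpan_pair {x y : Plane} (hne : x ≠ y) : IsLine line[ℝ, x, y] := by
  refine ⟨⟨x, left_mem_affineSpan_pair ℝ x y⟩, ?_⟩
  rw [direction_affineSpan, vectorSpan_pair]
  exact finrank_span_singleton (vsub_ne_zero.mpr hne)

/-- Every line is the zero set of an equation in normal form. -/
lemma IsLine.exists_height {l : AffineSubspace ℝ Plane} (hl : IsLine l) :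
    ∃ φ c, ∀ p, p ∈ l ↔ height φ p = c := by
  obtain ⟨⟨q, hq⟩, hd⟩ := hl
  obtain ⟨⟨v, hv⟩, hv0, hspan⟩ := finrank_eq_one_iff'.mp hd
  have hv0' : v ≠ 0 := fun h => hv0 (Subtype.ext h)
  set φ := Complex.arg ⟨v 0, v 1⟩ with hφ
  set R := ‖(⟨v 0, v 1⟩ : ℂ)‖ with hR
  have h0 : R * cos φ = v 0 := Complex.norm_mul_cos_arg ⟨v 0, v 1⟩
  have h1 : R * sin φ = v 1 := Complex.norm_mul_sin_arg ⟨v 0, v 1⟩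
  have hqv : height φ (v +ᵥ q) = height φ q := by
    simp only [height, vadd_eq_add, PiLp.add_apply]; rw [← h0, ← h1]; ring
  have hne : q ≠ v +ᵥ q := fun h => hv0' (by simpa using h.symm)
  refine ⟨φ, height φ q, fun p => ?_⟩
  rw [← mem_line_iff rfl hqv hne]
  have hle : line[ℝ, q, v +ᵥ q] ≤ l :=
    affineSpan_pair_le_of_mem_of_mem hq (AffineSubspace.vadd_mem_of_mem_direction hv hq)
  refine ⟨fun hp => ?_, fun hp => hle hp⟩
  obtain ⟨c, hc⟩ := hspan ⟨p -ᵥ q, AffineSubspace.vsub_mem_direction hp hq⟩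
  have hc' : c • v = p -ᵥ q := congrArg Subtype.val hc
  rw [mem_affineSpan_pair_iff_exists_lineMap_eq]
  refine ⟨c, ?_⟩
  rw [AffineMap.lineMap_apply, vadd_vsub, hc', vsub_vadd]

/-- The line at signed distance `c` from the origin with direction angle `φ`. -/
noncomputable def lineAt (φ c : ℝ) : AffineSubspace ℝ Plane :=
  line[ℝ, !₂[-c * sin φ, c * cos φ], !₂[-c * sin φ + cos φ, c * cos φ + sin φ]]

lemma lineAt_points_ne (φ c : ℝ) :
    (!₂[-c * sin φ, c * cos φ] : Plane) ≠ !₂[-c * sin φ + cos φ, c * cos φ + sin φ] := by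
  intro h
  have h0 : cos φ = 0 := by simpa using congrArg (fun p : Plane => p 0) h
  have h1 : sin φ = 0 := by simpa using congrArg (fun p : Plane => p 1) h
  simpa [h0, h1] using sin_sq_add_cos_sq φ

lemma mem_lineAt {φ c : ℝ} {p : Plane} : p ∈ lineAt φ c ↔ height φ p = c := by
  refine mem_line_iff ?_ ?_ (lineAt_points_ne φ c) p
  · simp [height]; linear_combination c * sin_sq_add_cos_sq φ
  · simp [height]; linear_combination c * sin_sq_add_cos_sq φ

lemma isLine_lineAt (φ c : ℝ) : IsLine (lineAt φ c) :=
  isLine_affineSpan_pair (lineAt_points_ne φ c)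

lemma direction_lineAt (φ c : ℝ) :
    (lineAt φ c).direction = Submodule.span ℝ {(!₂[cos φ, sin φ] : Plane)} := by
  rw [lineAt, direction_affineSpan, vectorSpan_pair_rev]
  congr 2
  apply plane_ext <;> simp

lemma sin_sub_eq_zero_of_parallel {φ ψ c d : ℝ} (h : (lineAt φ c).Parallel (lineAt ψ d)) :
    sin (φ - ψ) = 0 := by
  have hd := h.direction_eq
  rw [direction_lineAt, direction_lineAt] at hd
  have hm : (!₂[cos φ, sin φ] : Plane) ∈ Submodule.span ℝ {(!₂[cos ψ, sin ψ] : Plane)} := by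
    rw [← hd]; exact Submodule.mem_span_singleton_self _
  obtain ⟨t, ht⟩ := Submodule.mem_span_singleton.mp hm
  have h0 : t * cos ψ = cos φ := by simpa using congrArg (fun p : Plane => p 0) ht
  have h1 : t * sin ψ = sin φ := by simpa using congrArg (fun p : Plane => p 1) ht
  rw [sin_sub, ← h0, ← h1]; ring

/-- No point lies on three tangents to one circle about the origin. -/
lemma not_three_tangents {a b d c : ℝ} (hc : c ≠ 0) {p : Plane}
    (hab : sin (a - b) ≠ 0) (had : sin (a - d) ≠ 0) (hbd : sin (b - d) ≠ 0)
    (ha : height a p = c) (hb : height b p = c) (hd : height d p = c) : False := by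
  have half : ∀ {x : ℝ}, sin x ≠ 0 → sin (x / 2) ≠ 0 := fun {x} hx h0 => hx (by
    rw [show x = 2 * (x / 2) by ring, sin_two_mul, h0]; ring)
  have e1 := height_sub_height a b p
  have e2 := height_sub_height a d p
  rw [ha, hb, sub_self, eq_comm, mul_eq_zero, mul_eq_zero] at e1
  rw [ha, hd, sub_self, eq_comm, mul_eq_zero, mul_eq_zero] at e2
  replace e1 := (e1.resolve_left (by simp [half hab]))
  replace e2 := (e2.resolve_left (by simp [half had]))
  -- `p` is orthogonal to two independent directions, hence is the origin.
  have hs : sin ((a + b) / 2 - (a + d) / 2) ≠ 0 := by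
    have := half hbd
    rwa [show (a + b) / 2 - (a + d) / 2 = (b - d) / 2 by ring]
  have hz : sin ((a + b) / 2 - (a + d) / 2) * p 0 = 0 := by
    rw [sin_sub]; unfold along at e1 e2
    linear_combination sin ((a + b) / 2) * e2 - sin ((a + d) / 2) * e1
  have hz' : sin ((a + b) / 2 - (a + d) / 2) * p 1 = 0 := by
    rw [sin_sub]; unfold along at e1 e2
    linear_combination cos ((a + d) / 2) * e1 - cos ((a + b) / 2) * e2
  have p0 := (mul_eq_zero.mp hz).resolve_left hs
  have p1 := (mul_eq_zero.mp hz').resolve_left hs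
  exact hc (by rw [← ha, height, p0, p1]; ring)

/-! ### Sides of a line and faces -/

/-- The points `x` and `y` are not separated by `l`, and neither of them lies on `l`. -/
def SameSide (l : AffineSubspace ℝ Plane) (x y : Plane) : Prop := ∀ z ∈ segment ℝ x y, z ∉ l

lemma exists_mem_segment_height_eq {φ c : ℝ} {x y : Plane}
    (h : (height φ x - c) * (height φ y - c) ≤ 0) : ∃ z ∈ segment ℝ x y, height φ z = c := by
  have hpre : IsPreconnected (height φ '' segment ℝ x y) :=
    ((convex_segment x y).isPreconnected).image _ (continuous_height φ).continuousOn
  have hx : height φ x ∈ height φ '' segment ℝ x y := ⟨x, left_mem_segment ℝ x y, rfl⟩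
  have hy : height φ y ∈ height φ '' segment ℝ x y := ⟨y, right_mem_segment ℝ x y, rfl⟩
  rcases mul_nonpos_iff.mp h with ⟨h1, h2⟩ | ⟨h1, h2⟩
  · exact hpre.Icc_subset hy hx ⟨by linarith, by linarith⟩
  · exact hpre.Icc_subset hx hy ⟨by linarith, by linarith⟩

lemma sameSide_iff {l : AffineSubspace ℝ Plane} {φ c : ℝ} (hl : ∀ p, p ∈ l ↔ height φ p = c)
    {x y : Plane} : SameSide l x y ↔ 0 < (height φ x - c) * (height φ y - c) := by
  constructor
  · intro h
    by_contra! hn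
    obtain ⟨z, hz, hzc⟩ := exists_mem_segment_height_eq hn
    exact h z hz ((hl z).mpr hzc)
  · intro h z hz hzl
    rw [hl] at hzl
    rw [segment_eq_image_lineMap] at hz
    obtain ⟨t, ⟨ht0, ht1⟩, rfl⟩ := hz
    rw [height_lineMap] at hzl
    have hcomb : (1 - t) * (height φ x - c) + t * (height φ y - c) = 0 := by
      linear_combination hzl
    rcases ht0.eq_or_lt with rfl | ht
    · rw [zero_mul, add_zero, sub_zero, one_mul] at hcomb
      rw [hcomb, zero_mul] at h; exact lt_irrefl _ h
    · have h1 := mul_nonneg (sub_nonneg.mpr ht1) (sq_nonneg (height φ x - c))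
      have h2 := mul_pos ht h
      linarith [congrArg (fun s => s * (height φ x - c)) hcomb]

lemma SameSide.symm {l : AffineSubspace ℝ Plane} {x y : Plane} (h : SameSide l x y) :
    SameSide l y x := by
  unfold SameSide at *; rwa [segment_symm]

lemma SameSide.left_notMem {l : AffineSubspace ℝ Plane} {x y : Plane} (h : SameSide l x y) :
    x ∉ l := h x (left_mem_segment ℝ x y)

namespace IsLine

variable {l : AffineSubspace ℝ Plane} {x y z : Plane}

lemma sameSide_trans (hl : IsLine l) (h : SameSide l x y) (h' : SameSide l y z) :
    SameSide l x z := by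
  obtain ⟨φ, c, hc⟩ := hl.exists_height
  rw [sameSide_iff hc] at *
  rcases pos_and_pos_or_neg_and_neg_of_mul_pos h with ⟨h1, h2⟩ | ⟨h1, h2⟩ <;>
  rcases pos_and_pos_or_neg_and_neg_of_mul_pos h' with ⟨h3, h4⟩ | ⟨h3, h4⟩ <;> nlinarith

lemma sameSide_or_sameSide (hl : IsLine l) (hx : x ∉ l) (hy : y ∉ l) (hz : z ∉ l)
    (h : ¬ SameSide l x y) : SameSide l x z ∨ SameSide l y z := by
  obtain ⟨φ, c, hc⟩ := hl.exists_height
  rw [hc, ← sub_eq_zero] at hx hy hz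
  rw [sameSide_iff hc] at h
  rw [sameSide_iff hc, sameSide_iff hc]
  rcases lt_or_gt_of_ne hx with h1 | h1 <;> rcases lt_or_gt_of_ne hy with h2 | h2 <;>
  rcases lt_or_gt_of_ne hz with h3 | h3 <;>
  first
  | exact absurd (mul_pos h1 h2) h
  | exact absurd (mul_pos_of_neg_of_neg h1 h2) h
  | exact Or.inl (mul_pos h1 h3)
  | exact Or.inl (mul_pos_of_neg_of_neg h1 h3)
  | exact Or.inr (mul_pos h2 h3)
  | exact Or.inr (mul_pos_of_neg_of_neg h2 h3)

lemma sameSide_of_isPreconnected (hl : IsLine l) {f : Set Plane} (hf : IsPreconnected f)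
    (hfl : ∀ z ∈ f, z ∉ l) (hx : x ∈ f) (hy : y ∈ f) : SameSide l x y := by
  obtain ⟨φ, c, hc⟩ := hl.exists_height
  rw [sameSide_iff hc]
  by_contra! hn
  have hpre := hf.image _ (continuous_height φ).continuousOn
  have hx' := Set.mem_image_of_mem (height φ) hx
  have hy' := Set.mem_image_of_mem (height φ) hy
  have : c ∈ height φ '' f := by
    rcases mul_nonpos_iff.mp hn with ⟨h1, h2⟩ | ⟨h1, h2⟩
    · exact hpre.Icc_subset hy' hx' ⟨by linarith, by linarith⟩
    · exact hpre.Icc_subset hx' hy' ⟨by linarith, by linarith⟩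
  obtain ⟨z, hz, hzc⟩ := this
  exact hfl z hz ((hc z).mpr hzc)

lemma exists_sameSide_of_mem_closure (hl : IsLine l) {f : Set Plane} (hx : x ∈ closure f)
    (hxl : x ∉ l) : ∃ z ∈ f, SameSide l x z := by
  obtain ⟨φ, c, hc⟩ := hl.exists_height
  rw [hc, ← sub_eq_zero] at hxl
  have ho : IsOpen {z | 0 < (height φ x - c) * (height φ z - c)} :=
    isOpen_lt continuous_const
      (continuous_const.mul ((continuous_height φ).sub continuous_const))
  obtain ⟨z, hz, hzf⟩ := mem_closure_iff.mp hx _ ho (mul_self_pos.mpr hxl)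
  exact ⟨z, hzf, (sameSide_iff hc).mpr hz⟩

end IsLine

section Faces

variable {A : Set (AffineSubspace ℝ Plane)} {f g : Set Plane} {x y : Plane}

lemma mem_compl_lineUnion : x ∈ (lineUnion A)ᶜ ↔ ∀ l ∈ A, x ∉ l := by
  simp [lineUnion]

lemma IsFace.nonempty (hf : IsFace A f) : f.Nonempty := by
  obtain ⟨p, hp, rfl⟩ := hf
  exact ⟨p, mem_connectedComponentIn hp⟩

lemma IsFace.notMem (hf : IsFace A f) (hx : x ∈ f) {l : AffineSubspace ℝ Plane} (hl : l ∈ A) :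
    x ∉ l := by
  obtain ⟨p, hp, rfl⟩ := hf
  exact mem_compl_lineUnion.mp (connectedComponentIn_subset _ _ hx) l hl

lemma IsFace.sameSide (hA : ∀ l ∈ A, IsLine l) (hf : IsFace A f) (hx : x ∈ f) (hy : y ∈ f)
    {l : AffineSubspace ℝ Plane} (hl : l ∈ A) : SameSide l x y := by
  refine (hA l hl).sameSide_of_isPreconnected ?_ (fun z hz => hf.notMem hz hl) hx hy
  obtain ⟨p, hp, rfl⟩ := hf
  exact isPreconnected_connectedComponentIn

/-- A face is determined by the side of each line on which it lies. -/
lemma IsFace.eq_of_sameSide (hf : IsFace A f) (hg : IsFace A g) (hx : x ∈ f) (hy : y ∈ g)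
    (h : ∀ l ∈ A, SameSide l x y) : f = g := by
  obtain ⟨p, hp, rfl⟩ := hf
  obtain ⟨q, hq, rfl⟩ := hg
  rw [connectedComponentIn_eq hx, connectedComponentIn_eq hy]
  refine connectedComponentIn_eq ?_
  refine (convex_segment x y).isPreconnected.subset_connectedComponentIn
    (left_mem_segment ℝ x y) (fun z hz => ?_) (right_mem_segment ℝ x y)
  exact mem_compl_lineUnion.mpr fun l hl => h l hl z hz

/-- Two faces sharing an edge on `l` lie, for every other line, on the side of any point of that
edge. -/
lemma ShareEdgeOn.exists_witness (hA : ∀ l ∈ A, IsLine l) (hf : IsFace A f) (hg : IsFace A g)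
    {l : AffineSubspace ℝ Plane} (h : ShareEdgeOn A l f g) :
    ∃ p ∈ l, ∀ m ∈ A, m ≠ l → (∀ x ∈ f, SameSide m p x) ∧ ∀ x ∈ g, SameSide m p x := by
  obtain ⟨e, ⟨p, hp, rfl⟩, hef, heg⟩ := h
  have hpe := mem_connectedComponentIn hp
  refine ⟨p, hp.1, fun m hm hml => ?_⟩
  have hpm : p ∉ m := fun h => hp.2 (by
    simp only [lineUnion, Set.mem_iUnion]; exact ⟨m, ⟨hm, hml⟩, h⟩)
  constructor
  · intro x hx
    obtain ⟨z, hz, hpz⟩ := (hA m hm).exists_sameSide_of_mem_closure (hef hpe) hpm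
    exact (hA m hm).sameSide_trans hpz (hf.sameSide hA hz hx hm)
  · intro x hx
    obtain ⟨z, hz, hpz⟩ := (hA m hm).exists_sameSide_of_mem_closure (heg hpe) hpm
    exact (hA m hm).sameSide_trans hpz (hg.sameSide hA hz hx hm)

end Faces

/-! ### The symmetry axes of the regular polygon -/

/-- The signed distance of `p` from the axis of symmetry with direction angle `c * π / N`. -/
noncomputable def axis (N : ℕ) (c : ℤ) (p : Plane) : ℝ := height (c * π / N) p

/-- The open angular sector between the rays of angle `m * π / N` and `(m + 1) * π / N`. -/
def wedge (N : ℕ) (m : ℤ) : Set Plane := {p | 0 < axis N m p ∧ axis N (m + 1) p < 0}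

section Axes

variable {N : ℕ} {c m : ℤ} {p q z : Plane}

lemma axis_add_card (hN : 0 < N) (c : ℤ) (p : Plane) : axis N (c + N) p = -axis N c p := by
  have hN' : (N : ℝ) ≠ 0 := by positivity
  have : ((c + N : ℤ) : ℝ) * π / N = c * π / N + π := by push_cast; field_simp
  rw [axis, this, height, cos_add_pi, sin_add_pi, axis, height]; ring

lemma axis_add_two_mul (hN : 0 < N) (c q : ℤ) (p : Plane) :
    axis N (c + q * (2 * N)) p = axis N c p := by
  have hN' : (N : ℝ) ≠ 0 := by positivity
  have : ((c + q * (2 * N) : ℤ) : ℝ) * π / N = c * π / N + q * (2 * π) := by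
    push_cast; field_simp
  rw [axis, this, height, cos_add_int_mul_two_pi, sin_add_int_mul_two_pi, axis, height]

lemma axis_add_wedge (N : ℕ) (m d : ℤ) (p : Plane) :
    sin (π / N) * axis N (m + d) p =
      sin (d * π / N) * axis N (m + 1) p - sin ((d - 1) * π / N) * axis N m p := by
  have h1 : ((m + d : ℤ) : ℝ) * π / N = m * π / N + d * π / N := by push_cast; ring
  have h2 : ((m + 1 : ℤ) : ℝ) * π / N = m * π / N + π / N := by push_cast; ring
  have h3 : ((d : ℝ) - 1) * π / N = d * π / N - π / N := by ring
  unfold axis height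
  rw [h1, h2, h3]
  simp only [cos_add, sin_add, sin_sub]
  ring

lemma sin_mul_pi_div_pos {d : ℤ} (hd : 0 < d) (hdN : d < N) : 0 < sin (d * π / N) := by
  have hN : (0 : ℝ) < N := by exact_mod_cast hd.trans hdN
  have hd' : (0 : ℝ) < d := by exact_mod_cast hd
  have hdN' : (d : ℝ) < N := by exact_mod_cast hdN
  refine sin_pos_of_pos_of_lt_pi (by positivity) ?_
  rw [div_lt_iff₀ hN]
  nlinarith [pi_pos]

lemma axis_neg_of_mem_wedge (hp : p ∈ wedge N m) {d : ℤ} (hd : 1 ≤ d) (hdN : d ≤ N) :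
    axis N (m + d) p < 0 := by
  have hN : 0 < N := by lia
  rcases hdN.eq_or_lt with rfl | hlt
  · rw [axis_add_card hN]; linarith [hp.1]
  rcases hd.eq_or_lt with rfl | h1
  · exact hp.2
  have h := axis_add_wedge N m d p
  have s1 := sin_mul_pi_div_pos (N := N) (d := 1) one_pos (by lia)
  have s2 := sin_mul_pi_div_pos (N := N) (d := d) (by lia) hlt
  have s3 := sin_mul_pi_div_pos (N := N) (d := d - 1) (by lia) (by lia)
  push_cast at s1 s3
  rw [one_mul] at s1
  have := mul_neg_of_pos_of_neg s2 hp.2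
  have := mul_pos s3 hp.1
  by_contra! hn
  have := mul_nonneg s1.le hn
  linarith

lemma axis_pos_of_mem_wedge (hp : p ∈ wedge N m) {d : ℤ} (hd : 0 ≤ d) (hdN : d < N) :
    0 < axis N (m - d) p := by
  have h := axis_neg_of_mem_wedge hp (d := N - d) (by lia) (by lia)
  rw [show m + (N - d) = m - d + (N : ℤ) by ring, axis_add_card (by lia)] at h
  linarith

/-- An axis does not separate two points of the same sector. -/
lemma axis_mul_pos_of_mem_wedge (hN : 0 < N) (hp : p ∈ wedge N m) (hq : q ∈ wedge N m) (c : ℤ) :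
    0 < axis N c p * axis N c q := by
  have hmod := Int.emod_add_mul_ediv (c - m - 1) (2 * N)
  have h0 := Int.emod_nonneg (c - m - 1) (b := 2 * N) (by lia)
  have h1 := Int.emod_lt_of_pos (c - m - 1) (b := 2 * N) (by lia)
  set d := (c - m - 1) % (2 * N)
  set s := (c - m - 1) / (2 * N)
  have hc : c = m + (d + 1) + s * (2 * N) := by linear_combination -hmod
  rw [hc, axis_add_two_mul hN, axis_add_two_mul hN]
  rcases le_or_gt (d + 1) N with h | h
  · exact mul_pos_of_neg_of_neg (axis_neg_of_mem_wedge hp (by lia) h)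
      (axis_neg_of_mem_wedge hq (by lia) h)
  · have e : m + (d + 1) = m + (d + 1 - N) + (N : ℤ) := by ring
    rw [e, axis_add_card hN, axis_add_card hN, neg_mul_neg]
    exact mul_pos_of_neg_of_neg (axis_neg_of_mem_wedge hp (by lia) (by lia))
      (axis_neg_of_mem_wedge hq (by lia) (by lia))

lemma eq_of_mem_wedge {a b : ℤ} (ha : 0 ≤ a) (ha' : a < 2 * N) (hb : 0 ≤ b) (hb' : b < 2 * N)
    (hpa : p ∈ wedge N a) (hpb : p ∈ wedge N b) : a = b := by
  have key : ∀ {a b : ℤ}, 0 ≤ a → b < 2 * N → p ∈ wedge N a → p ∈ wedge N b → ¬ a < b := by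
    intro a b ha hb hpa hpb hab
    rcases le_or_gt (b - a) N with h | h
    · have := axis_neg_of_mem_wedge hpa (d := b - a) (by lia) h
      rw [add_sub_cancel] at this
      exact lt_asymm this hpb.1
    · have := axis_neg_of_mem_wedge hpa (d := b + 1 - a - N) (by lia) (by lia)
      have h2 := hpb.2
      rw [show b + 1 = a + (b + 1 - a - N) + (N : ℤ) by ring, axis_add_card (by lia)] at h2
      linarith
  exact le_antisymm (not_lt.mp (key hb ha' hpb hpa)) (not_lt.mp (key ha hb' hpa hpb))

lemma mem_wedge_of_mem_segment (hp : p ∈ wedge N m) (hq : q ∈ wedge N m)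
    (hz : z ∈ segment ℝ p q) : z ∈ wedge N m := by
  rw [segment_eq_image_lineMap] at hz
  obtain ⟨t, ⟨h0, h1⟩, rfl⟩ := hz
  obtain ⟨hp1, hp2⟩ := hp
  obtain ⟨hq1, hq2⟩ := hq
  unfold axis at hp1 hp2 hq1 hq2
  constructor
  · rw [axis, height_lineMap]
    rcases h0.eq_or_lt with rfl | h0
    · simpa using hp1
    · nlinarith [mul_pos h0 hq1]
  · rw [axis, height_lineMap]
    rcases h0.eq_or_lt with rfl | h0
    · simpa using hp2
    · nlinarith [mul_neg_of_pos_of_neg h0 hq2]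

lemma mem_wedge_of_polar {r θ : ℝ} (hN : 0 < N) (hr : 0 < r) (h1 : m * π / N < θ)
    (h2 : θ < (m + 1) * π / N) : (!₂[r * cos θ, r * sin θ] : Plane) ∈ wedge N m := by
  have hN' : (1 : ℝ) ≤ N := by exact_mod_cast hN
  have hw : ((m : ℝ) + 1) * π / N - m * π / N ≤ π := by
    rw [← sub_div, ← sub_mul, add_sub_cancel_left, one_mul]
    exact div_le_self pi_pos.le hN'
  constructor
  · rw [axis, height_polar]
    exact mul_pos hr (sin_pos_of_pos_of_lt_pi (by linarith) (by linarith))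
  · rw [axis, height_polar]
    push_cast
    exact mul_neg_of_pos_of_neg hr (sin_neg_of_neg_of_neg_pi_lt (by linarith) (by linarith))

lemma slab_subset_wedge (hN : 0 < N) (m : ℕ) : slab N m ⊆ wedge N m := by
  rintro p ⟨⟨r, θ, hr, h1, h2, rfl⟩, -⟩
  exact mem_wedge_of_polar hN hr (by exact_mod_cast h1) (by exact_mod_cast h2)

/-- Sectors at cyclic distance at least three are separated by three consecutive axes. -/
lemma exists_three_separating_axes {a b : ℤ} (ha : 0 ≤ a) (ha' : a < 2 * N) (hb : 0 ≤ b)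
    (hb' : b < 2 * N) (hab : a ≠ b) (ha3 : 3 ∣ a) (hb3 : 3 ∣ b) (hN3 : 3 ∣ N)
    (hp : p ∈ wedge N a) (hq : q ∈ wedge N b) :
    ∃ c, ∀ d : ℤ, 0 ≤ d → d ≤ 2 → axis N (c + d) p * axis N (c + d) q < 0 := by
  have near : ∀ {a b : ℤ} {p q : Plane}, 3 ≤ b - a → b - a ≤ N → p ∈ wedge N a → q ∈ wedge N b →
      ∃ c, ∀ d : ℤ, 0 ≤ d → d ≤ 2 → axis N (c + d) p * axis N (c + d) q < 0 := by
    intro a b p q h3 hN hp hq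
    refine ⟨a + 1, fun d hd hd' => ?_⟩
    have h1 := axis_neg_of_mem_wedge hp (d := 1 + d) (by lia) (by lia)
    have h2 := axis_pos_of_mem_wedge hq (d := b - (a + 1 + d)) (by lia) (by lia)
    rw [← add_assoc] at h1
    rw [sub_sub_cancel] at h2
    exact mul_neg_of_neg_of_pos h1 h2
  have shift : ∀ {a : ℤ} {p : Plane}, p ∈ wedge N a → p ∈ wedge N (a + 1 * (2 * N)) := by
    intro a p hp
    have hN : 0 < N := by lia
    refine ⟨?_, ?_⟩
    · rw [axis_add_two_mul hN]; exact hp.1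
    · rw [add_right_comm, axis_add_two_mul hN]; exact hp.2
  have comm : ∀ {p q : Plane}, (∃ c, ∀ d : ℤ, 0 ≤ d → d ≤ 2 →
      axis N (c + d) q * axis N (c + d) p < 0) →
      ∃ c, ∀ d : ℤ, 0 ≤ d → d ≤ 2 → axis N (c + d) p * axis N (c + d) q < 0 :=
    fun ⟨c, hc⟩ => ⟨c, fun d h0 h2 => by rw [mul_comm]; exact hc d h0 h2⟩
  rcases lt_or_gt_of_ne hab with h | h
  · rcases le_or_gt (b - a) N with h' | h'
    · exact near (by lia) h' hp hq
    · exact comm (near (by lia) (by lia) hq (shift hp))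
  · rcases le_or_gt (a - b) N with h' | h'
    · exact comm (near (by lia) h' hq hp)
    · exact near (by lia) (by lia) hp (shift hq)

end Axes

/-! ### The side lines of the regular polygon -/

/-- The signed distance of `p` from the `i`-th side line, positive away from the polygon. -/
noncomputable def sideDist (N : ℕ) (i : ℤ) (p : Plane) : ℝ :=
  along ((2 * i + 1) * π / N) p - cos (π / N)

section Sides

variable {N : ℕ} {p q z : Plane}

lemma sideDist_add_mul (hN : 0 < N) (i s : ℤ) (p : Plane) :
    sideDist N (i + s * N) p = sideDist N i p := by
  have hN' : (N : ℝ) ≠ 0 := by positivity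
  have : (2 * ((i + s * N : ℤ) : ℝ) + 1) * π / N = (2 * i + 1) * π / N + s * (2 * π) := by
    push_cast; field_simp; ring
  rw [sideDist, this, along, cos_add_int_mul_two_pi, sin_add_int_mul_two_pi, sideDist, along]

lemma sideDist_congr (hN : 0 < N) {i j : ℤ} (h : i ≡ j [ZMOD N]) (p : Plane) :
    sideDist N i p = sideDist N j p := by
  obtain ⟨s, hs⟩ := h.dvd
  rw [show j = i + s * N by linear_combination hs, sideDist_add_mul hN]

lemma sideDist_sub_sideDist (N : ℕ) (i j : ℤ) (p : Plane) :
    sideDist N i p - sideDist N j p = 2 * sin ((i - j) * π / N) * axis N (i + j + 1) p := by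
  have e1 : ((2 * (i : ℝ) + 1) * π / N - (2 * j + 1) * π / N) / 2 = (i - j) * π / N := by ring
  have e2 : ((2 * (i : ℝ) + 1) * π / N + (2 * j + 1) * π / N) / 2 =
      ((i + j + 1 : ℤ) : ℝ) * π / N := by
    push_cast; ring
  rw [sideDist, sideDist, sub_sub_sub_cancel_right, along_sub_along, axis, e1, e2]

lemma sideDist_lineMap (N : ℕ) (i : ℤ) (x y : Plane) (t : ℝ) :
    sideDist N i (AffineMap.lineMap x y t) = (1 - t) * sideDist N i x + t * sideDist N i y := by
  rw [sideDist, along_lineMap, sideDist, sideDist]; ring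

lemma sideDist_pos_of_mem_segment {i : ℤ} (hp : 0 < sideDist N i p) (hq : 0 < sideDist N i q)
    (hz : z ∈ segment ℝ p q) : 0 < sideDist N i z := by
  rw [segment_eq_image_lineMap] at hz
  obtain ⟨t, ⟨h0, h1⟩, rfl⟩ := hz
  rw [sideDist_lineMap]
  rcases h0.eq_or_lt with rfl | h0
  · simpa using hp
  · nlinarith [mul_pos h0 hq]

lemma polygonVertex_eq_polar (N i : ℕ) :
    polygonVertex N i = !₂[1 * cos (2 * π * i / N), 1 * sin (2 * π * i / N)] := by
  rw [one_mul, one_mul]; rfl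

lemma mem_sideLine_iff (hN : 3 ≤ N) (i : ℕ) (p : Plane) :
    p ∈ sideLine N i ↔ height ((2 * i + 1) * π / N - π / 2) p = cos (π / N) := by
  have hN' : (3 : ℝ) ≤ N := by exact_mod_cast hN
  have hs : 0 < sin (π / N) := sin_pos_of_pos_of_lt_pi (by positivity) (by
    rw [div_lt_iff₀ (by positivity)]; nlinarith [pi_pos])
  have e1 : 2 * π * (i : ℕ) / N - (2 * i + 1) * π / N = -(π / N) := by ring
  have e2 : 2 * π * ((i + 1 : ℕ) : ℝ) / N - (2 * i + 1) * π / N = π / N := by push_cast; ring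
  refine mem_line_iff ?_ ?_ ?_ p
  · rw [height_sub_pi_div_two, polygonVertex_eq_polar, along_polar, e1, cos_neg, one_mul]
  · rw [height_sub_pi_div_two, polygonVertex_eq_polar, along_polar, e2, one_mul]
  · intro h
    have := congrArg (height ((2 * i + 1) * π / N)) h
    rw [polygonVertex_eq_polar, polygonVertex_eq_polar, height_polar, height_polar, e1, e2,
      sin_neg] at this
    linarith

lemma sideLine_eq_lineAt (hN : 3 ≤ N) (i : ℕ) :
    sideLine N i = lineAt ((2 * i + 1) * π / N - π / 2) (cos (π / N)) := by
  ext p; rw [mem_sideLine_iff hN, mem_lineAt]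

lemma sameSide_sideLine_iff (hN : 3 ≤ N) (i : ℕ) {x y : Plane} :
    SameSide (sideLine N i) x y ↔ 0 < sideDist N i x * sideDist N i y := by
  rw [sameSide_iff (mem_sideLine_iff hN i), height_sub_pi_div_two, height_sub_pi_div_two]
  simp [sideDist]

lemma eq_of_sin_sub_eq_zero (hN : Odd N) {i j : ℕ} (hi : i < N) (hj : j < N)
    (h : sin (((2 * i + 1) * π / N - π / 2) - ((2 * j + 1) * π / N - π / 2)) = 0) : i = j := by
  obtain ⟨n, hn⟩ := sin_eq_zero_iff.mp h
  have hN' : (N : ℝ) ≠ 0 := by have := hN.pos; positivity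
  have h1 : (n : ℝ) * N = 2 * (i - j) := by
    field_simp at hn
    linear_combination hn / 2
  have h2 : n * N = 2 * ((i : ℤ) - j) := by exact_mod_cast h1
  obtain ⟨M, rfl⟩ := hN
  have hn1 : n < 2 := by by_contra! hc; push_cast at h2; nlinarith
  have hn2 : -2 < n := by by_contra! hc; push_cast at h2; nlinarith
  interval_cases n <;> push_cast at h2 <;> lia

lemma sideLine_injective (hN : 3 ≤ N) (hodd : Odd N) {i j : ℕ} (hi : i < N) (hj : j < N)
    (h : sideLine N i = sideLine N j) : i = j := by
  rw [sideLine_eq_lineAt hN, sideLine_eq_lineAt hN] at h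
  refine eq_of_sin_sub_eq_zero hodd hi hj
    (sin_sub_eq_zero_of_parallel (c := cos (π / N)) (d := cos (π / N)) ?_)
  rw [h]

lemma cos_le_cos_of_mem_Icc {a x : ℝ} (ha : 0 ≤ a) (h1 : a ≤ x) (h2 : x ≤ 2 * π - a) :
    cos x ≤ cos a := by
  have h := cos_sub_cos a x
  have s1 := sin_nonneg_of_nonneg_of_le_pi (x := (a + x) / 2) (by linarith) (by linarith)
  have s2 := sin_nonneg_of_nonneg_of_le_pi (x := (x - a) / 2) (by linarith) (by linarith)
  rw [show (a - x) / 2 = -((x - a) / 2) by ring, sin_neg] at h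
  nlinarith [mul_nonneg s1 s2]

lemma cos_odd_mul_le (hN : 0 < N) (i : ℤ) : cos ((2 * i + 1) * π / N) ≤ cos (π / N) := by
  have hN' : (0 : ℝ) < N := by exact_mod_cast hN
  have hmod := Int.emod_add_mul_ediv i N
  have h0 := Int.emod_nonneg i (b := N) (by lia)
  have h1 := Int.emod_lt_of_pos i (b := N) (by lia)
  set d := i % N
  set s := i / N
  have hi : (i : ℝ) = d + N * s := by exact_mod_cast hmod.symm
  have e : (2 * (i : ℝ) + 1) * π / N = (2 * d + 1) * π / N + s * (2 * π) := by
    rw [hi]; field_simp; ring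
  have h0' : (0 : ℝ) ≤ d := by exact_mod_cast h0
  have h1' : (d : ℝ) + 1 ≤ N := by exact_mod_cast h1
  rw [e, cos_add_int_mul_two_pi]
  refine cos_le_cos_of_mem_Icc (by positivity) ?_ ?_
  · gcongr; nlinarith [pi_pos]
  · rw [div_le_iff₀ hN', sub_mul, div_mul_cancel₀ _ hN'.ne']; nlinarith [pi_pos]

lemma sideDist_nonpos_of_mem_polygon (hN : 0 < N) (i : ℤ) (hp : p ∈ polygon N) :
    sideDist N i p ≤ 0 := by
  have hconv : Convex ℝ {p | sideDist N i p ≤ 0} := by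
    intro x hx y hy a b ha hb hab
    have : a • x + b • y = AffineMap.lineMap x y b := by
      rw [AffineMap.lineMap_apply_module, ← hab, add_sub_cancel_right]
    show sideDist N i (a • x + b • y) ≤ 0
    rw [this, sideDist_lineMap, ← hab, add_sub_cancel_right]
    exact add_nonpos (mul_nonpos_of_nonneg_of_nonpos ha hx) (mul_nonpos_of_nonneg_of_nonpos hb hy)
  refine convexHull_min ?_ hconv hp
  rintro _ ⟨j, rfl⟩
  show sideDist N i (polygonVertex N j) ≤ 0
  rw [sideDist, polygonVertex_eq_polar, along_polar, one_mul, sub_nonpos]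
  convert cos_odd_mul_le hN ((j : ℤ) - i - 1) using 2
  push_cast; ring

lemma exists_polar (p : Plane) (θ₀ : ℝ) :
    ∃ r θ, 0 ≤ r ∧ θ₀ ≤ θ ∧ p = !₂[r * cos θ, r * sin θ] := by
  obtain ⟨n, hn⟩ := exists_nat_ge ((θ₀ - Complex.arg ⟨p 0, p 1⟩) / (2 * π))
  refine ⟨‖(⟨p 0, p 1⟩ : ℂ)‖, Complex.arg ⟨p 0, p 1⟩ + n * (2 * π), norm_nonneg _, ?_, ?_⟩
  · rw [div_le_iff₀ two_pi_pos] at hn; linarith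
  · rw [cos_add_nat_mul_two_pi, sin_add_nat_mul_two_pi]
    apply plane_ext
    · simp
    · simp

/-- The sides on the far half of the polygon do not separate `p` from it: only the `M + 1` sides
whose normals make an acute angle with `p` can do so. -/
lemma exists_far_sides {M : ℕ} (hM : 1 ≤ M) (p : Plane) :
    ∃ n : ℕ, ∀ i : ℕ, n + M + 1 ≤ i → i ≤ n + 2 * M → sideDist (2 * M + 1) i p < 0 := by
  obtain ⟨r, θ, hr, hθ, rfl⟩ := exists_polar p (4 * π)
  set N := 2 * M + 1 with hNdef
  have hN : (N : ℝ) = 2 * M + 1 := by simp [hNdef]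
  have hM' : (1 : ℝ) ≤ M := by exact_mod_cast hM
  have hN0 : (0 : ℝ) < N := by linarith
  set s := θ * N / π with hs
  have hθs : θ = s * π / N := by rw [hs]; field_simp
  have hs4 : 4 * (N : ℝ) ≤ s := by
    rw [hs, le_div_iff₀ pi_pos]; nlinarith [pi_pos]
  -- The window of `N` consecutive sides starts just before the first acute one.
  obtain ⟨n, hn1, hn2⟩ : ∃ n : ℕ, (s - N / 2 - 1) / 2 ≤ n ∧ (n : ℝ) < (s - N / 2 - 1) / 2 + 1 :=
    ⟨_, Nat.le_ceil _, Nat.ceil_lt_add_one (by linarith)⟩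
  refine ⟨n, fun i h1 h2 => ?_⟩
  have h1' : (n : ℝ) + M + 1 ≤ i := by exact_mod_cast h1
  have h2' : (i : ℝ) ≤ n + 2 * M := by exact_mod_cast h2
  rw [sideDist, along_polar]
  have hc : 0 < cos (π / N) := cos_pos_of_mem_Ioo
    ⟨by have : 0 < π / N := by positivity
        linarith [pi_pos],
      by rw [div_lt_div_iff₀ hN0 two_pos]; nlinarith [pi_pos]⟩
  have hcos : cos (θ - (2 * ((i : ℤ) : ℝ) + 1) * π / N) ≤ 0 := by
    rw [← cos_neg, show -(θ - (2 * ((i : ℤ) : ℝ) + 1) * π / N) = (2 * i + 1 - s) * π / N by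
      rw [hθs]; push_cast; ring]
    apply cos_nonpos_of_pi_div_two_le_of_le
    · rw [div_le_div_iff₀ two_pos hN0]; nlinarith [pi_pos]
    · rw [div_le_iff₀ hN0]; nlinarith [pi_pos]
  have := mul_nonpos_of_nonneg_of_nonpos hr hcos
  linarith

/-- The number of side lines that separate `p` from the polygon. -/
noncomputable def level (N : ℕ) (p : Plane) : ℕ :=
  open Classical in ((Finset.range N).filter fun i : ℕ => 0 < sideDist N i p).card

lemma level_le {M : ℕ} (hM : 1 ≤ M) (p : Plane) : level (2 * M + 1) p ≤ M + 1 := by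
  classical
  obtain ⟨n, hn⟩ := exists_far_sides hM p
  have hper : Function.Periodic (fun i : ℕ => 0 < sideDist (2 * M + 1) i p) (2 * M + 1) := by
    intro i
    have := sideDist_add_mul (N := 2 * M + 1) (by lia) i 1 p
    rw [one_mul] at this
    simp only [Nat.cast_add] at this ⊢
    rw [this]
  have h := Nat.filter_Ico_card_eq_of_periodic n (2 * M + 1) _ hper
  rw [Nat.count_eq_card_filter_range] at h
  have hlev : level (2 * M + 1) p =
      ((Finset.range (2 * M + 1)).filter fun i : ℕ => 0 < sideDist (2 * M + 1) i p).card := by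
    unfold level; congr
  rw [hlev, ← h]
  calc _ ≤ (Finset.Ico n (n + (M + 1))).card := by
        apply Finset.card_le_card
        intro i hi
        rw [Finset.mem_filter, Finset.mem_Ico] at hi
        rw [Finset.mem_Ico]
        by_contra hc
        exact lt_asymm hi.2 (hn i (by lia) (by lia))
    _ = M + 1 := by simp

lemma level_pos_iff : 0 < level N p ↔ ∃ i : ℕ, i < N ∧ 0 < sideDist N i p := by
  classical
  unfold level
  rw [Finset.card_pos]
  simp [Finset.Nonempty]

lemma notMem_polygon_of_level_pos (h : 0 < level N p) : p ∉ polygon N := by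
  obtain ⟨i, hi, hpos⟩ := level_pos_iff.mp h
  exact fun hp => not_lt.mpr (sideDist_nonpos_of_mem_polygon (by lia) i hp) hpos

/-- Inside a sector the side lines do not cross, so the number of side lines separating a point
from the polygon determines which ones do. -/
lemma sideDist_pos_iff_of_level_eq {m : ℤ} (hp : p ∈ wedge N m) (hq : q ∈ wedge N m)
    (h : level N p = level N q) {i : ℕ} (hi : i < N) :
    0 < sideDist N i p ↔ 0 < sideDist N i q := by
  classical
  have key : ∀ {p q : Plane}, p ∈ wedge N m → q ∈ wedge N m → level N p = level N q →
      0 < sideDist N i p → 0 < sideDist N i q := by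
    intro p q hp hq h hip
    by_contra hiq
    have hss : (Finset.range N).filter (fun j : ℕ => 0 < sideDist N j q) ⊂
        (Finset.range N).filter (fun j : ℕ => 0 < sideDist N j p) := by
      rw [Finset.ssubset_iff_of_subset]
      · exact ⟨i, by simp [hi, hip], by simp [hiq]⟩
      · intro j hj
        rw [Finset.mem_filter] at hj ⊢
        refine ⟨hj.1, ?_⟩
        by_contra hjp
        have h1 := sideDist_sub_sideDist N i j p
        have h2 := sideDist_sub_sideDist N i j q
        have h3 := axis_mul_pos_of_mem_wedge (by lia) hp hq (i + j + 1)
        have h4 : 0 < sideDist N i p - sideDist N j p := by linarith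
        have h5 : sideDist N i q - sideDist N j q < 0 := by linarith [hj.2]
        rw [h1] at h4
        rw [h2] at h5
        have h6 := mul_neg_of_pos_of_neg h4 h5
        nlinarith [mul_nonneg (sq_nonneg (2 * sin (((i : ℤ) - (j : ℤ)) * π / N))) h3.le]
    have := Finset.card_lt_card hss
    unfold level at h
    convert absurd h this.ne' using 1
  exact ⟨key hp hq h, key hq hp h.symm⟩

lemma level_eq_add_one {r : ℕ} (hr : r < N) (hrp : ¬ 0 < sideDist N r p)
    (hrq : 0 < sideDist N r q)
    (h : ∀ i : ℕ, i < N → i ≠ r → (0 < sideDist N i p ↔ 0 < sideDist N i q)) :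
    level N q = level N p + 1 := by
  classical
  unfold level
  rw [← Finset.card_insert_of_notMem (a := r) (by simp [hrp])]
  congr 1
  ext i
  simp only [Finset.mem_filter, Finset.mem_range, Finset.mem_insert]
  by_cases hir : i = r
  · simp [hir, hr, hrq]
  · constructor
    · rintro ⟨h1, h2⟩; exact Or.inr ⟨h1, (h i h1 hir).mpr h2⟩
    · rintro (h1 | ⟨h1, h2⟩)
      · exact absurd h1 hir
      · exact ⟨h1, (h i h1 hir).mp h2⟩

/-! ### Adjacent cells of the side lines do not meet distant sectors -/

/-- A set of residues modulo an odd `N` that is invariant under two reflections whose product is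
the rotation by one or two is empty or everything. -/
lemma forall_of_two_reflections (hN : Odd N) {S : ℤ → Prop}
    (hper : ∀ i s : ℤ, S (i + s * N) ↔ S i) {c e : ℤ} (he : e = 1 ∨ e = 2)
    (h1 : ∀ i, S i → S (c - 1 - i)) (h2 : ∀ i, S i → S (c + e - 1 - i)) {i : ℤ} (hi : S i) (j : ℤ) :
    S j := by
  have rot : ∀ i, S i → S (i + e) := fun i hi => by
    have := h2 _ (h1 i hi)
    rwa [show c + e - 1 - (c - 1 - i) = i + e by ring] at this
  have iter : ∀ (d : ℤ), (∀ i, S i → S (i + d)) → ∀ (n : ℕ) (i : ℤ), S i → S (i + n * d) := by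
    intro d hd n
    induction n with
    | zero => intro i hi; simpa using hi
    | succ n ih =>
      intro i hi
      have := hd _ (ih i hi)
      rwa [show i + n * d + d = i + (n + 1 : ℕ) * d by push_cast; ring] at this
  have rot1 : ∀ i, S i → S (i + 1) := by
    rcases he with rfl | rfl
    · exact rot
    · intro i hi
      obtain ⟨M, rfl⟩ := hN
      have := iter 2 rot (M + 1) i hi
      rw [← hper _ 1]
      convert this using 1
      push_cast; ring
  have hpos : (N : ℤ) ≠ 0 := by have := hN.pos; lia
  have h := iter 1 rot1 ((j - i) % N).toNat i hi
  rw [Int.toNat_of_nonneg (Int.emod_nonneg _ hpos)] at h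
  rw [← hper _ ((j - i) / N)] at h
  have := Int.emod_add_mul_ediv (j - i) N
  rwa [show i + (j - i) % N * 1 + (j - i) / N * N = j by linear_combination this] at h

/-- If exactly one side line separates `p` from `q`, and it separates `q` but not `p` from the
polygon, then for each axis between `p` and `q` one of the two sets of side lines separating `p`,
resp. `q`, from the polygon is symmetric about that axis. -/
lemma symmetric_of_axis_separates (hN : 0 < N) {r : ℤ} (hrp : ¬ 0 < sideDist N r p)
    (hrq : 0 < sideDist N r q)
    (h : ∀ i : ℤ, ¬ i ≡ r [ZMOD N] → (0 < sideDist N i p ↔ 0 < sideDist N i q))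
    {c : ℤ} (hc : axis N c p * axis N c q < 0) :
    (∀ i, 0 < sideDist N i p → 0 < sideDist N (c - 1 - i) p) ∨
      ∀ i, 0 < sideDist N i q → 0 < sideDist N (c - 1 - i) q := by
  have hsub : ∀ i, 0 < sideDist N i p → 0 < sideDist N i q := fun i hi => by
    refine (h i fun hir => hrp ?_).mp hi
    rwa [← sideDist_congr hN hir]
  have key : ∀ i, 0 < sideDist N i p → 0 < sideDist N (c - 1 - i) p ∨ c - 1 - i ≡ r [ZMOD N] := by
    intro i hi
    by_contra! hn
    obtain ⟨hn1, hn2⟩ := hn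
    have hjq : sideDist N (c - 1 - i) q ≤ 0 := not_lt.mp fun hj =>
      not_lt.mpr hn1 ((h _ hn2).mpr hj)
    have hiq := hsub i hi
    have h1 := sideDist_sub_sideDist N i (c - 1 - i) p
    have h2 := sideDist_sub_sideDist N i (c - 1 - i) q
    rw [show i + (c - 1 - i) + 1 = c by ring] at h1 h2
    have h3 : 0 < sideDist N i p - sideDist N (c - 1 - i) p := by linarith
    have h4 : 0 < sideDist N i q - sideDist N (c - 1 - i) q := by linarith
    rw [h1] at h3
    rw [h2] at h4
    have h5 := mul_pos h3 h4
    nlinarith [mul_nonneg (sq_nonneg (2 * sin (((i : ℝ) - ((c - 1 - i : ℤ) : ℝ)) * π / N)))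
      (neg_nonneg.mpr hc.le)]
  by_cases hsym : ∀ i, 0 < sideDist N i p → 0 < sideDist N (c - 1 - i) p
  · exact Or.inl hsym
  right
  push Not at hsym
  obtain ⟨j, hj, hj'⟩ := hsym
  have hjr := (key j hj).resolve_left (not_lt.mpr hj')
  intro i hi
  by_cases hir : i ≡ r [ZMOD N]
  · -- The mirror image of the exceptional line is the line `j`.
    have : c - 1 - i ≡ j [ZMOD N] := by
      have := (Int.ModEq.refl (c - 1)).sub (hir.trans hjr.symm)
      rwa [sub_sub_cancel] at this
    rw [sideDist_congr hN this]
    exact hsub j hj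
  · rcases key i ((h i hir).mpr hi) with h' | h'
    · exact hsub _ h'
    · rwa [sideDist_congr hN h']

/-- Two points outside the polygon that are separated by three consecutive axes are separated by
more than one side line. Among the three axes, two preserve the same one of the two sets of
separating side lines, so that set is invariant under a rotation generating all rotations. -/
lemma not_three_separating_axes {M : ℕ} (hM : 1 ≤ M) (hN : N = 2 * M + 1) {r : ℤ}
    (hrp : ¬ 0 < sideDist N r p) (hrq : 0 < sideDist N r q)
    (h : ∀ i : ℤ, ¬ i ≡ r [ZMOD N] → (0 < sideDist N i p ↔ 0 < sideDist N i q))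
    (hp : ∃ i, 0 < sideDist N i p) {c : ℤ}
    (hc : ∀ d : ℤ, 0 ≤ d → d ≤ 2 → axis N (c + d) p * axis N (c + d) q < 0) : False := by
  have hodd : Odd N := ⟨M, hN⟩
  have hper : ∀ (x : Plane) (i s : ℤ), 0 < sideDist N (i + s * N) x ↔ 0 < sideDist N i x :=
    fun x i s => by rw [sideDist_add_mul hodd.pos]
  have notp : ∀ {c e : ℤ}, (e = 1 ∨ e = 2) →
      (∀ i, 0 < sideDist N i p → 0 < sideDist N (c - 1 - i) p) →
      (∀ i, 0 < sideDist N i p → 0 < sideDist N (c + e - 1 - i) p) → False := by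
    intro c e he h1 h2
    obtain ⟨i, hi⟩ := hp
    exact hrp (forall_of_two_reflections (S := fun i => 0 < sideDist N i p) hodd (hper p) he h1 h2
      hi r)
  have notq : ∀ {c e : ℤ}, (e = 1 ∨ e = 2) →
      (∀ i, 0 < sideDist N i q → 0 < sideDist N (c - 1 - i) q) →
      (∀ i, 0 < sideDist N i q → 0 < sideDist N (c + e - 1 - i) q) → False := by
    intro c e he h1 h2
    obtain ⟨n, hn⟩ := exists_far_sides hM q
    rw [← hN] at hn
    exact lt_asymm (hn (n + M + 1) le_rfl (by lia))
      (forall_of_two_reflections (S := fun i => 0 < sideDist N i q) hodd (hper q) he h1 h2 hrq _)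
  have sym := fun d h0 h2 => symmetric_of_axis_separates hodd.pos hrp hrq h (hc d h0 h2)
  have e0 := sym 0 le_rfl (by norm_num)
  have e1 := sym 1 (by norm_num) (by norm_num)
  have e2 := sym 2 (by norm_num) le_rfl
  rw [add_zero] at e0
  rcases e0 with e0 | e0 <;> rcases e1 with e1 | e1 <;> rcases e2 with e3 | e3
  · exact notp (Or.inl rfl) e0 e1
  · exact notp (Or.inl rfl) e0 e1
  · exact notp (Or.inr rfl) e0 e3
  · exact notq (c := c + 1) (e := 1) (Or.inl rfl) e1 (by rwa [show c + 1 + 1 = c + 2 by ring])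
  · exact notp (c := c + 1) (e := 1) (Or.inl rfl) e1 (by rwa [show c + 1 + 1 = c + 2 by ring])
  · exact notq (Or.inr rfl) e0 e3
  · exact notq (Or.inl rfl) e0 e1
  · exact notq (Or.inl rfl) e0 e1

end Sides

/-! ### Counting cells along a path -/

section Counting

variable {m D s : ℕ} {lev slabIdx : ℕ → ℕ}

/-- A sequence of cells whose levels change by one, which stays in one of `s` slabs while its level
is positive, and which meets every cell of positive level at most once. Between two cells of level
one no level exceeds one, since otherwise a cell of level one would be repeated; so levels above
one occur only in an initial and in a final run, and levels zero and one alternate in between. -/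
theorem length_le_of_levels (hD2 : 2 ≤ D)
    (hstep : ∀ x, x + 1 < m → lev (x + 1) = lev x + 1 ∨ lev x = lev (x + 1) + 1)
    (hD : ∀ x < m, lev x ≤ D) (hs : ∀ x < m, 1 ≤ lev x → slabIdx x < s)
    (hsame : ∀ x, x + 1 < m → 1 ≤ lev x → 1 ≤ lev (x + 1) → slabIdx x = slabIdx (x + 1))
    (hinj : ∀ x < m, ∀ y < m, 1 ≤ lev x → lev x = lev y → slabIdx x = slabIdx y → x = y) :
    m ≤ 2 * s + 2 * (D - 1) := by
  classical
  rcases Nat.eq_zero_or_pos m with rfl | hm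
  · exact Nat.zero_le _
  have const : ∀ x y, x ≤ y → y < m → (∀ z, x ≤ z → z ≤ y → 1 ≤ lev z) →
      slabIdx x = slabIdx y := by
    intro x y hxy
    induction y, hxy using Nat.le_induction with
    | base => intros; rfl
    | succ y hxy ih =>
      intro hy h
      rw [ih (by lia) fun z h1 h2 => h z h1 (by lia)]
      exact hsame y hy (h y hxy (by lia)) (h (y + 1) (by lia) le_rfl)
  have back : ∀ x, x < m → 2 ≤ lev x → (∃ y ≤ x, lev y < 2) →
      ∃ y < x, lev y = 1 ∧ ∀ z, y ≤ z → z ≤ x → 1 ≤ lev z := by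
    intro x
    induction x with
    | zero => rintro - h ⟨y, hy, hy'⟩; rw [Nat.le_zero.mp hy] at hy'; lia
    | succ x ih =>
      rintro hx h ⟨y, hy, hy'⟩
      by_cases h2 : 2 ≤ lev x
      · have hyx : y ≤ x := by
          rcases hy.eq_or_lt with rfl | h' <;> lia
        obtain ⟨w, hw, hw1, hw2⟩ := ih (by lia) h2 ⟨y, hyx, hy'⟩
        refine ⟨w, by lia, hw1, fun z h1 h3 => ?_⟩
        rcases h3.eq_or_lt with rfl | h3
        · lia
        · exact hw2 z h1 (by lia)
      · have := hstep x hx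
        refine ⟨x, by lia, by lia, fun z h1 h3 => ?_⟩
        have : z = x ∨ z = x + 1 := by lia
        rcases this with rfl | rfl <;> lia
  have forth : ∀ n x, x + n + 1 = m → 2 ≤ lev x → (∃ y, x ≤ y ∧ y < m ∧ lev y < 2) →
      ∃ y, x < y ∧ y < m ∧ lev y = 1 ∧ ∀ z, x ≤ z → z ≤ y → 1 ≤ lev z := by
    intro n
    induction n with
    | zero => rintro x hx h ⟨y, h1, h2, h3⟩; rw [show y = x by lia] at h3; lia
    | succ n ih =>
      rintro x hx h ⟨y, h1, h2, h3⟩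
      by_cases h4 : 2 ≤ lev (x + 1)
      · have hyx : x + 1 ≤ y := by
          rcases h1.eq_or_lt with rfl | h' <;> lia
        obtain ⟨w, hw, hwm, hw1, hw2⟩ := ih (x + 1) (by lia) h4 ⟨y, hyx, h2, h3⟩
        refine ⟨w, by lia, hwm, hw1, fun z h5 h6 => ?_⟩
        rcases h5.eq_or_lt with rfl | h5
        · lia
        · exact hw2 z (by lia) h6
      · have := hstep x (by lia)
        refine ⟨x + 1, by lia, by lia, by lia, fun z h5 h6 => ?_⟩
        have : z = x ∨ z = x + 1 := by lia
        rcases this with rfl | rfl <;> lia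
  set I := (Finset.range m).filter fun x => ∀ y ≤ x, 2 ≤ lev y with hI
  set F := (Finset.range m).filter fun x => ∀ y, x ≤ y → y < m → 2 ≤ lev y with hF
  set Z := (Finset.range m).filter fun x => lev x = 0 with hZ
  set O := (Finset.range m).filter fun x => lev x = 1 with hO
  have cover : Finset.range m ⊆ (I ∪ F) ∪ (Z ∪ O) := by
    intro x hx
    have hxm := Finset.mem_range.mp hx
    simp only [hI, hF, hZ, hO, Finset.mem_union, Finset.mem_filter]
    by_cases h2 : 2 ≤ lev x
    · left
      by_contra! hcon
      obtain ⟨hc1, hc2⟩ := hcon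
      obtain ⟨y, hy, hy1, hy2⟩ := back x hxm h2 (hc1 hx)
      obtain ⟨z, hz, hzm, hz1, hz2⟩ := forth (m - x - 1) x (by lia) h2 (hc2 hx)
      have hA : slabIdx y = slabIdx z := const y z (by lia) hzm fun w h1 h3 => by
        rcases le_or_gt w x with h | h
        · exact hy2 w h1 h
        · exact hz2 w h.le h3
      have := hinj y (by lia) z hzm (by lia) (by lia) hA
      lia
    · right
      have : lev x = 0 ∨ lev x = 1 := by lia
      exact this.imp (fun h => ⟨hx, h⟩) (fun h => ⟨hx, h⟩)
  have cardI : I.card ≤ D - 1 := by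
    have : I.card ≤ (Finset.Icc 2 D).card := by
      refine Finset.card_le_card_of_injOn lev (fun x hx => ?_) fun x hx y hy hxy => ?_
      · rw [hI, Finset.mem_coe, Finset.mem_filter, Finset.mem_range] at hx
        rw [Finset.mem_coe, Finset.mem_Icc]
        exact ⟨hx.2 x le_rfl, hD x hx.1⟩
      · rw [hI, Finset.mem_coe, Finset.mem_filter, Finset.mem_range] at hx hy
        have hx2 := hx.2 x le_rfl
        refine hinj x hx.1 y hy.1 (by lia) hxy ?_
        rcases le_total x y with h | h
        · exact const x y h hy.1 fun z _ h2 => by have := hy.2 z h2; lia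
        · exact (const y x h hx.1 fun z _ h2 => by have := hx.2 z h2; lia).symm
    rw [Nat.card_Icc] at this; lia
  have cardF : F.card ≤ D - 1 := by
    have : F.card ≤ (Finset.Icc 2 D).card := by
      refine Finset.card_le_card_of_injOn lev (fun x hx => ?_) fun x hx y hy hxy => ?_
      · rw [hF, Finset.mem_coe, Finset.mem_filter, Finset.mem_range] at hx
        rw [Finset.mem_coe, Finset.mem_Icc]
        exact ⟨hx.2 x le_rfl hx.1, hD x hx.1⟩
      · rw [hF, Finset.mem_coe, Finset.mem_filter, Finset.mem_range] at hx hy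
        have hx2 := hx.2 x le_rfl hx.1
        refine hinj x hx.1 y hy.1 (by lia) hxy ?_
        rcases le_total x y with h | h
        · exact const x y h hy.1 fun z h1 h2 => by have := hx.2 z h1 (by lia); lia
        · exact (const y x h hx.1 fun z h1 h2 => by have := hy.2 z h1 (by lia); lia).symm
    rw [Nat.card_Icc] at this; lia
  have cardO : O.card ≤ s := by
    rw [← Finset.card_range s]
    refine Finset.card_le_card_of_injOn slabIdx (fun x hx => ?_) fun x hx y hy hxy => ?_
    · rw [hO, Finset.mem_coe, Finset.mem_filter, Finset.mem_range] at hx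
      rw [Finset.mem_coe, Finset.mem_range]
      exact hs x hx.1 (by lia)
    · rw [hO, Finset.mem_coe, Finset.mem_filter, Finset.mem_range] at hx hy
      exact hinj x hx.1 y hy.1 (by lia) (by lia) hxy
  -- The cell after a cell of level zero has level one.
  have cardZ' : (Z.erase (m - 1)).card ≤ O.card := by
    refine Finset.card_le_card_of_injOn (fun x => x + 1) (fun x hx => ?_) fun x _ y _ h => by
      simpa using h
    rw [hZ, Finset.mem_coe, Finset.mem_erase, Finset.mem_filter, Finset.mem_range] at hx
    rw [hO, Finset.mem_coe, Finset.mem_filter, Finset.mem_range]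
    have := hstep x (by lia)
    exact ⟨by lia, by lia⟩
  have total : m ≤ (I.card + F.card) + (Z.card + O.card) := by
    calc m = (Finset.range m).card := (Finset.card_range m).symm
      _ ≤ _ := Finset.card_le_card cover
      _ ≤ _ := (Finset.card_union_le _ _).trans
        (Nat.add_le_add (Finset.card_union_le _ _) (Finset.card_union_le _ _))
  by_cases hlast : 2 ≤ lev (m - 1)
  · have : Z.erase (m - 1) = Z := Finset.erase_eq_of_notMem fun h => by
      rw [hZ, Finset.mem_filter] at h; lia
    rw [this] at cardZ'
    lia
  · have hF0 : F.card = 0 := by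
      rw [Finset.card_eq_zero, Finset.eq_empty_iff_forall_notMem]
      intro x hx
      rw [hF, Finset.mem_filter, Finset.mem_range] at hx
      exact hlast (hx.2 (m - 1) (by lia) (by lia))
    have := Finset.pred_card_le_card_erase (s := Z) (a := m - 1)
    lia

end Counting

/-! ### Cells visited by an alternating path -/

/-- The configuration of the construction, without any condition of general position: the red lines
extend the sides of the regular `3 * k`-gon, and the blue lines `t j 0`, `t j 1` form `k` pairs that
lie in opposite marked slabs and do not meet outside the polygon. -/
structure IsSlabArrangement (k : ℕ) (A : BicoloredArrangement)
    (t : Fin k → Fin 2 → AffineSubspace ℝ Plane) : Prop where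
  mem_red : ∀ l, l ∈ A.red ↔ ∃ i < 3 * k, l = sideLine (3 * k) i
  mem_blue : ∀ l, l ∈ A.blue ↔ ∃ j b, l = t j b
  slabs : ∀ (j : Fin k) b, LiesInMarkedSlabs k j (t j b)
  twins : ∀ j p, p ∈ t j 0 → p ∈ t j 1 → p ∈ polygon (3 * k)

/-- The point `p` witnesses that `f` and `g` are the two faces at an edge on `l`: it lies on `l`,
and on the same side as `f` and `g` of every other line. -/
def IsWitness (A : Set (AffineSubspace ℝ Plane)) (l : AffineSubspace ℝ Plane) (p : Plane)
    (f g : Set Plane) : Prop :=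
  p ∈ l ∧ ∀ m ∈ A, m ≠ l → (∀ x ∈ f, SameSide m p x) ∧ ∀ x ∈ g, SameSide m p x

section Witnesses

variable {A : Set (AffineSubspace ℝ Plane)} {l : AffineSubspace ℝ Plane} {p : Plane}
  {f g : Set Plane}

lemma IsWitness.not_sameSide (hA : ∀ l ∈ A, IsLine l) (hw : IsWitness A l p f g)
    (hf : IsFace A f) (hg : IsFace A g) (hfg : f ≠ g) {x y : Plane}
    (hx : x ∈ f) (hy : y ∈ g) : ¬ SameSide l x y := fun h =>
  hfg (hf.eq_of_sameSide hg hx hy fun m hm => by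
    by_cases hml : m = l
    · rwa [hml]
    · exact (hA m hm).sameSide_trans ((hw.2 m hm hml).1 x hx).symm ((hw.2 m hm hml).2 y hy))

/-- For any point off `l`, one of the two faces at an edge on `l` lies on the side of that point. -/
lemma IsWitness.exists_sameSide (hA : ∀ l ∈ A, IsLine l) (hl : l ∈ A) (hw : IsWitness A l p f g)
    (hf : IsFace A f) (hg : IsFace A g) (hfg : f ≠ g) {z : Plane} (hz : z ∉ l) :
    ∃ h, (h = f ∨ h = g) ∧ IsFace A h ∧ (∃ x ∈ h, SameSide l x z) ∧
      ∀ m ∈ A, m ≠ l → ∀ x ∈ h, SameSide m p x := by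
  obtain ⟨x, hx⟩ := hf.nonempty
  obtain ⟨y, hy⟩ := hg.nonempty
  rcases (hA l hl).sameSide_or_sameSide (hf.notMem hx hl) (hg.notMem hy hl) hz
    (hw.not_sameSide hA hf hg hfg hx hy) with h | h
  · exact ⟨f, Or.inl rfl, hf, ⟨x, hx, h⟩, fun m hm hml => (hw.2 m hm hml).1⟩
  · exact ⟨g, Or.inr rfl, hg, ⟨y, hy, h⟩, fun m hm hml => (hw.2 m hm hml).2⟩

end Witnesses

lemma BicoloredArrangement.isLine (A : BicoloredArrangement) : ∀ l ∈ A.lines, IsLine l :=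
  fun l hl => hl.elim (A.isLine_red l) (A.isLine_blue l)

namespace IsSlabArrangement

variable {k : ℕ} {A : BicoloredArrangement} {t : Fin k → Fin 2 → AffineSubspace ℝ Plane}
  {p q : Plane} {b b' r : AffineSubspace ℝ Plane} {f g f' g' : Set Plane}

lemma sideLine_mem (h : IsSlabArrangement k A t) {i : ℕ} (hi : i < 3 * k) :
    sideLine (3 * k) i ∈ A.lines := Or.inl ((h.mem_red _).mpr ⟨i, hi, rfl⟩)

lemma eq_or_of_mem_slab (h : IsSlabArrangement k A t) {j : Fin k} {s : Fin 2} {a : ℕ}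
    (ha : a < 2 * k) (hp : p ∈ t j s) (hpP : p ∉ polygon (3 * k))
    (hpa : p ∈ wedge (3 * k) (3 * a : ℕ)) : a = j ∨ a = j + k := by
  have hk : 0 < 3 * k := by lia
  have hj := j.isLt
  rcases h.slabs j s ⟨hp, hpP⟩ with h1 | h1
  · have := eq_of_mem_wedge (by lia) (by lia) (by lia) (by lia) hpa (slab_subset_wedge hk _ h1)
    lia
  · have := eq_of_mem_wedge (by lia) (by lia) (by lia) (by lia) hpa (slab_subset_wedge hk _ h1)
    lia

lemma exists_wedge (h : IsSlabArrangement k A t) (hb : b ∈ A.blue) (hp : p ∈ b)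
    (hpP : p ∉ polygon (3 * k)) : ∃ a < 2 * k, p ∈ wedge (3 * k) (3 * a : ℕ) := by
  obtain ⟨j, s, rfl⟩ := (h.mem_blue b).mp hb
  have hj := j.isLt
  have hk : 0 < 3 * k := by lia
  rcases h.slabs j s ⟨hp, hpP⟩ with h1 | h1
  · exact ⟨j, by lia, slab_subset_wedge hk _ h1⟩
  · refine ⟨j + k, by lia, ?_⟩
    rw [show 3 * ((j : ℕ) + k) = 3 * j + 3 * k by ring]
    exact slab_subset_wedge hk _ h1

/-- Two points on blue lines in the same slab and at the same positive level are separated by no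
line, except possibly by those two lines themselves. -/
lemma sameSide_of_same_cell (h : IsSlabArrangement k A t) (hb : b ∈ A.blue) (hb' : b' ∈ A.blue)
    (hp : p ∈ b) (hq : q ∈ b') (hlev : level (3 * k) p = level (3 * k) q)
    (hpos : 0 < level (3 * k) p) {a : ℕ} (ha : a < 2 * k)
    (hpa : p ∈ wedge (3 * k) (3 * a : ℕ)) (hqa : q ∈ wedge (3 * k) (3 * a : ℕ))
    {l : AffineSubspace ℝ Plane} (hl : l ∈ A.lines) (hlb : l ≠ b) (hlb' : l ≠ b')
    (hpl : p ∉ l) (hql : q ∉ l) : SameSide l p q := by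
  have hk : 3 ≤ 3 * k := by lia
  have hiff := fun {i : ℕ} (hi : i < 3 * k) => sideDist_pos_iff_of_level_eq hpa hqa hlev hi
  rcases hl with hl | hl
  · obtain ⟨i, hi, rfl⟩ := (h.mem_red l).mp hl
    rw [sameSide_sideLine_iff hk]
    have hne : ∀ {x}, x ∉ sideLine (3 * k) i → sideDist (3 * k) i x ≠ 0 := fun {x} hx h0 =>
      hx ((mem_sideLine_iff hk i x).mpr (by
        rw [height_sub_pi_div_two]; simpa [sideDist, sub_eq_zero] using h0))
    rcases lt_or_gt_of_ne (hne hpl) with h1 | h1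
    · refine mul_pos_of_neg_of_neg h1 (lt_of_le_of_ne ?_ (hne hql))
      exact not_lt.mp fun h2 => lt_asymm h1 ((hiff hi).mpr h2)
    · exact mul_pos h1 ((hiff hi).mp h1)
  · intro z hz hzl
    obtain ⟨i, hi, hip⟩ := level_pos_iff.mp hpos
    have hzP : z ∉ polygon (3 * k) := fun hzP =>
      not_lt.mpr (sideDist_nonpos_of_mem_polygon (by lia) i hzP)
        (sideDist_pos_of_mem_segment hip ((hiff hi).mp hip) hz)
    have hza := mem_wedge_of_mem_segment hpa hqa hz
    obtain ⟨j, s, rfl⟩ := (h.mem_blue l).mp hl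
    obtain ⟨j₁, s₁, rfl⟩ := (h.mem_blue b).mp hb
    obtain ⟨j₂, s₂, rfl⟩ := (h.mem_blue b').mp hb'
    have e := h.eq_or_of_mem_slab ha hzl hzP hza
    have e₁ := h.eq_or_of_mem_slab ha hp (notMem_polygon_of_level_pos hpos) hpa
    have e₂ := h.eq_or_of_mem_slab ha hq (notMem_polygon_of_level_pos (hlev ▸ hpos)) hqa
    have hj := j.isLt
    have hj₁ := j₁.isLt
    have hj₂ := j₂.isLt
    obtain rfl : j = j₁ := Fin.ext (by lia)
    obtain rfl : j = j₂ := Fin.ext (by lia)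
    have hs₁ : s ≠ s₁ := fun h => hlb (by rw [h])
    have hs₂ : s ≠ s₂ := fun h => hlb' (by rw [h])
    obtain rfl : s₁ = s₂ := by lia
    -- Both points lie on the same blue line, so `z` would be a crossing of twins.
    have hzb : z ∈ t j s₁ := (t j s₁).convex.segment_subset hp hq hz
    apply hzP
    obtain ⟨rfl, rfl⟩ | ⟨rfl, rfl⟩ : (s = 0 ∧ s₁ = 1) ∨ (s = 1 ∧ s₁ = 0) := by lia
    · exact h.twins j z hzl hzb
    · exact h.twins j z hzb hzl

/-- Two blue steps in the same cell have a face in common. -/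
lemma exists_common_face (h : IsSlabArrangement k A t) (hb : b ∈ A.blue) (hb' : b' ∈ A.blue)
    (hw : IsWitness A.lines b p f g) (hw' : IsWitness A.lines b' q f' g')
    (hf : IsFace A.lines f) (hg : IsFace A.lines g) (hfg : f ≠ g)
    (hf' : IsFace A.lines f') (hg' : IsFace A.lines g') (hfg' : f' ≠ g')
    (hlev : level (3 * k) p = level (3 * k) q)
    (hpos : 0 < level (3 * k) p) {a : ℕ} (ha : a < 2 * k)
    (hpa : p ∈ wedge (3 * k) (3 * a : ℕ)) (hqa : q ∈ wedge (3 * k) (3 * a : ℕ)) :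
    ∃ e, (e = f ∨ e = g) ∧ (e = f' ∨ e = g') := by
  have hA := A.isLine
  obtain ⟨x, hx⟩ := hf.nonempty
  obtain ⟨x', hx'⟩ := hf'.nonempty
  have off : ∀ l ∈ A.lines, l ≠ b → p ∉ l := fun l hl hlb => ((hw.2 l hl hlb).1 x hx).left_notMem
  have off' : ∀ l ∈ A.lines, l ≠ b' → q ∉ l := fun l hl hlb =>
    ((hw'.2 l hl hlb).1 x' hx').left_notMem
  have hside : ∀ l ∈ A.lines, l ≠ b → l ≠ b' → SameSide l p q := fun l hl h1 h2 =>
    h.sameSide_of_same_cell hb hb' hw.1 hw'.1 hlev hpos ha hpa hqa hl h1 h2 (off l hl h1)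
      (off' l hl h2)
  by_cases hbb : b = b'
  · subst hbb
    obtain ⟨e, he, heF, ⟨y, hy, hyx⟩, hep⟩ := hw.exists_sameSide hA (Or.inr hb) hf hg hfg
      (hf'.notMem hx' (Or.inr hb))
    refine ⟨e, he, Or.inl (heF.eq_of_sameSide hf' hy hx' fun m hm => ?_)⟩
    by_cases hmb : m = b
    · rwa [hmb]
    · exact (hA m hm).sameSide_trans (hep m hm hmb y hy).symm
        ((hA m hm).sameSide_trans (hside m hm hmb hmb) ((hw'.2 m hm hmb).1 x' hx'))
  · -- The common face lies on the side of `q` for `b` and on the side of `p` for `b'`.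
    obtain ⟨e, he, heF, ⟨y, hy, hyq⟩, hep⟩ := hw.exists_sameSide hA (Or.inr hb) hf hg hfg
      (off' b (Or.inr hb) hbb)
    obtain ⟨e', he', heF', ⟨y', hy', hyp⟩, hep'⟩ := hw'.exists_sameSide hA (Or.inr hb') hf' hg' hfg'
      (off b' (Or.inr hb') (Ne.symm hbb))
    refine ⟨e, he, ?_⟩
    rw [heF.eq_of_sameSide heF' hy hy' fun m hm => ?_]
    · exact he'
    by_cases hmb : m = b
    · subst hmb
      exact (hA m hm).sameSide_trans hyq (hep' m hm hbb y' hy')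
    by_cases hmb' : m = b'
    · subst hmb'
      exact (hA m hm).sameSide_trans (hep m hm hmb y hy).symm hyp.symm
    · exact (hA m hm).sameSide_trans (hep m hm hmb y hy).symm
        ((hA m hm).sameSide_trans (hside m hm hmb hmb') (hep' m hm hmb' y' hy'))

/-- Two points on the sides of the two faces of a red edge lie on adjacent levels, and in the same
marked slab if both are outside the polygon. -/
lemma red_step (h : IsSlabArrangement k A t) (hodd : Odd k) (hr : r ∈ A.red) {z : Plane}
    (hw : IsWitness A.lines r z f g)
    (hf : IsFace A.lines f) (hg : IsFace A.lines g) (hfg : f ≠ g)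
    (hpf : ∀ l ∈ A.red, ∀ x ∈ f, SameSide l p x) (hqg : ∀ l ∈ A.red, ∀ x ∈ g, SameSide l q x) :
    (level (3 * k) q = level (3 * k) p + 1 ∨ level (3 * k) p = level (3 * k) q + 1) ∧
      (0 < level (3 * k) p → 0 < level (3 * k) q → ∀ a < 2 * k, ∀ c < 2 * k,
        p ∈ wedge (3 * k) (3 * a : ℕ) → q ∈ wedge (3 * k) (3 * c : ℕ) → a = c) := by
  have hA := A.isLine
  have hk := hodd.pos
  have hN3 : 3 ≤ 3 * k := by lia
  have hoddN : Odd (3 * k) := by rw [Nat.odd_mul]; exact ⟨by decide, hodd⟩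
  obtain ⟨M, hM⟩ := hoddN
  obtain ⟨x, hx⟩ := hf.nonempty
  obtain ⟨y, hy⟩ := hg.nonempty
  obtain ⟨i₀, hi₀, rfl⟩ := (h.mem_red r).mp hr
  have hprod : ∀ i < 3 * k, i ≠ i₀ → 0 < sideDist (3 * k) i p * sideDist (3 * k) i q := by
    intro i hi hne
    have hred := (h.mem_red _).mpr ⟨i, hi, rfl⟩
    have hm := h.sideLine_mem hi
    have hne' : sideLine (3 * k) i ≠ sideLine (3 * k) i₀ := fun he =>
      hne (sideLine_injective hN3 ⟨M, hM⟩ hi hi₀ he)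
    obtain ⟨w1, w2⟩ := hw.2 _ hm hne'
    rw [← sameSide_sideLine_iff hN3]
    exact (hA _ hm).sameSide_trans (hpf _ hred x hx) ((hA _ hm).sameSide_trans (w1 x hx).symm
      ((hA _ hm).sameSide_trans (w2 y hy) (hqg _ hred y hy).symm))
  have hprod₀ : sideDist (3 * k) i₀ p * sideDist (3 * k) i₀ q < 0 := by
    have hm := h.sideLine_mem hi₀
    have h1 := hpf _ hr x hx
    have h2 := hqg _ hr y hy
    have h3 : ¬ SameSide (sideLine (3 * k) i₀) p q := fun h3 =>
      hw.not_sameSide hA hf hg hfg hx hy ((hA _ hm).sameSide_trans h1.symm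
        ((hA _ hm).sameSide_trans h3 h2))
    rw [sameSide_sideLine_iff hN3] at h1 h2 h3
    refine lt_of_le_of_ne (not_lt.mp h3) (mul_ne_zero ?_ ?_)
    · rintro h0; rw [h0, zero_mul] at h1; exact lt_irrefl _ h1
    · rintro h0; rw [h0, zero_mul] at h2; exact lt_irrefl _ h2
  -- The statement is symmetric, so the red line may be assumed to separate `q` from the polygon.
  have main : ∀ {p q : Plane},
      (∀ i < 3 * k, i ≠ i₀ → 0 < sideDist (3 * k) i p * sideDist (3 * k) i q) →
      sideDist (3 * k) i₀ p < 0 → 0 < sideDist (3 * k) i₀ q →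
      level (3 * k) q = level (3 * k) p + 1 ∧
      (0 < level (3 * k) p → 0 < level (3 * k) q → ∀ a < 2 * k, ∀ c < 2 * k,
        p ∈ wedge (3 * k) (3 * a : ℕ) → q ∈ wedge (3 * k) (3 * c : ℕ) → a = c) := by
    intro p q hprod hp hq
    have hiff : ∀ i : ℕ, i < 3 * k → i ≠ i₀ →
        (0 < sideDist (3 * k) i p ↔ 0 < sideDist (3 * k) i q) := fun i hi hne =>
      pos_iff_pos_of_mul_pos (hprod i hi hne)
    refine ⟨level_eq_add_one hi₀ (not_lt.mpr hp.le) hq hiff, ?_⟩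
    intro hlp hlq a ha c hc hpa hqc
    by_contra hac
    obtain ⟨d, hd⟩ := exists_three_separating_axes (N := 3 * k) (by lia) (by lia) (by lia) (by lia)
      (by lia) ⟨a, by push_cast; ring⟩ ⟨c, by push_cast; ring⟩ (Dvd.intro k rfl) hpa hqc
    obtain ⟨i, hi, hip⟩ := level_pos_iff.mp hlp
    refine not_three_separating_axes (M := M) (by lia) hM (r := i₀) (not_lt.mpr hp.le) hq ?_
      ⟨i, hip⟩ hd
    intro i hi
    have hN0 : ((3 * k : ℕ) : ℤ) ≠ 0 := by lia
    have h0 := Int.emod_nonneg i hN0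
    have h1 := Int.emod_lt_of_pos i (b := (3 * k : ℕ)) (by lia)
    have hcong : i ≡ ((i % (3 * k : ℕ)).toNat : ℤ) [ZMOD (3 * k : ℕ)] := by
      rw [Int.toNat_of_nonneg h0]; exact (Int.mod_modEq _ _).symm
    rw [sideDist_congr (by lia) hcong, sideDist_congr (by lia) hcong]
    refine hiff _ (by lia) fun he => hi ?_
    rwa [he] at hcong
  rcases mul_neg_iff.mp hprod₀ with ⟨h1, h2⟩ | ⟨h1, h2⟩
  · obtain ⟨m1, m2⟩ := main (fun i hi hne => by rw [mul_comm]; exact hprod i hi hne) h2 h1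
    exact ⟨Or.inr m1, fun h3 h4 a ha c hc hpa hqc => (m2 h4 h3 c hc a ha hqc hpa).symm⟩
  · obtain ⟨m1, m2⟩ := main hprod h1 h2
    exact ⟨Or.inl m1, m2⟩

/-- The blue steps of an alternating path visit distinct cells, consecutive ones being adjacent. -/
theorem alternating_path_length_le (h : IsSlabArrangement k A t) (hodd : Odd k)
    {f g : Face A.lines} (w : (dualGraph A.lines).Walk f g) (hpath : w.IsPath)
    (halt : A.IsAlternating w) : w.support.length ≤ 14 * k := by
  have hA := A.isLine
  have hk := hodd.pos
  set n := w.length with hn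
  set v := w.getVert with hv
  have hadj : ∀ x < n, (dualGraph A.lines).Adj (v x) (v (x + 1)) := fun x hx =>
    w.adj_getVert_succ hx
  have hne : ∀ x < n, (v x).1 ≠ (v (x + 1)).1 := fun x hx he => (hadj x hx).1 (Subtype.ext he)
  have hinjv : ∀ x ≤ n, ∀ y ≤ n, (v x).1 = (v y).1 → x = y := fun x hx y hy he =>
    hpath.getVert_injOn hx hy (Subtype.ext he)
  have hcol : ∀ x < n, A.RedContact (v x) (v (x + 1)) ∨ A.BlueContact (v x) (v (x + 1)) := by
    intro x hx
    obtain ⟨-, l, hl | hl, hs⟩ := hadj x hx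
    · exact Or.inl ⟨l, hl, hs⟩
    · exact Or.inr ⟨l, hl, hs⟩
  have hchain : ∀ x, x + 1 < n →
      ¬ (A.RedContact (v x) (v (x + 1)) ∧ A.RedContact (v (x + 1)) (v (x + 1 + 1))) ∧
      ¬ (A.BlueContact (v x) (v (x + 1)) ∧ A.BlueContact (v (x + 1)) (v (x + 1 + 1))) := by
    intro x hx
    have hx' : x + 1 < w.darts.length := by rwa [w.length_darts]
    have := List.isChain_iff_getElem.mp halt x hx'
    simpa [SimpleGraph.Walk.darts_getElem_eq_getVert] using this
  -- From the first blue step on, the steps are alternately blue and red.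
  obtain ⟨e, he, hblue⟩ : ∃ e ≤ 1, ∀ x, (e + 2 * x < n → A.BlueContact (v (e + 2 * x))
      (v (e + 2 * x + 1))) ∧ (e + 2 * x + 1 < n → A.RedContact (v (e + 2 * x + 1))
      (v (e + 2 * x + 1 + 1))) := by
    have step : ∀ e, (e < n → A.BlueContact (v e) (v (e + 1))) → ∀ x,
        (e + 2 * x < n → A.BlueContact (v (e + 2 * x)) (v (e + 2 * x + 1))) ∧
        (e + 2 * x + 1 < n → A.RedContact (v (e + 2 * x + 1)) (v (e + 2 * x + 1 + 1))) := by
      intro e h0 x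
      have red : ∀ y, (y < n → A.BlueContact (v y) (v (y + 1))) →
          y + 1 < n → A.RedContact (v (y + 1)) (v (y + 1 + 1)) := fun y hy hy1 =>
        (hcol (y + 1) hy1).resolve_right fun hb => (hchain y hy1).2 ⟨hy (by lia), hb⟩
      induction x with
      | zero => exact ⟨h0, red e h0⟩
      | succ x ih =>
        have hb : e + 2 * (x + 1) < n → A.BlueContact (v (e + 2 * (x + 1)))
            (v (e + 2 * (x + 1) + 1)) := fun hx =>
          (hcol _ hx).resolve_left fun hr => (hchain (e + 2 * x + 1) hx).1 ⟨ih.2 (by lia), hr⟩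
        exact ⟨hb, red _ hb⟩
    by_cases hb : 0 < n → A.BlueContact (v 0) (v (0 + 1))
    · exact ⟨0, zero_le_one, step 0 hb⟩
    · push Not at hb
      refine ⟨1, le_rfl, step 1 fun h1 => (hcol 1 h1).resolve_left fun hr => ?_⟩
      exact (hchain 0 h1).1 ⟨(hcol 0 hb.1).resolve_right hb.2, hr⟩
  set m := (n - e + 1) / 2 with hm
  have hwit : ∀ x < m, ∃ l ∈ A.blue, ∃ p, IsWitness A.lines l p (v (e + 2 * x)).1
      (v (e + 2 * x + 1)).1 := by
    intro x hx
    obtain ⟨l, hl, hs⟩ := (hblue x).1 (by lia)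
    exact ⟨l, hl, hs.exists_witness hA (v _).2 (v _).2⟩
  choose! b hb p hp using hwit
  set lev : ℕ → ℕ := fun x => level (3 * k) (p x) with hlev
  have hwedge : ∀ x < m, 1 ≤ lev x → ∃ a < 2 * k, p x ∈ wedge (3 * k) (3 * a : ℕ) :=
    fun x hx hl => h.exists_wedge (hb x hx) (hp x hx).1 (notMem_polygon_of_level_pos hl)
  choose! a ha hpa using hwedge
  have hstep : ∀ x, x + 1 < m → (lev (x + 1) = lev x + 1 ∨ lev x = lev (x + 1) + 1) ∧
      (0 < lev x → 0 < lev (x + 1) → ∀ a < 2 * k, ∀ c < 2 * k,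
        p x ∈ wedge (3 * k) (3 * a : ℕ) → p (x + 1) ∈ wedge (3 * k) (3 * c : ℕ) → a = c) := by
    intro x hx
    obtain ⟨r, hr, hs⟩ := (hblue x).2 (by lia)
    obtain ⟨z, hz⟩ := hs.exists_witness hA (v _).2 (v _).2
    have hrb : ∀ l ∈ A.red, ∀ y < m, l ≠ b y := fun l hl y hy he =>
      Finset.disjoint_left.mp A.disjoint hl (he ▸ hb y hy)
    refine h.red_step hodd hr hz (v _).2 (v _).2 (hne _ (by lia)) ?_ ?_
    · exact fun l hl => ((hp x (by lia)).2 l (Or.inl hl) (hrb l hl x (by lia))).2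
    · exact fun l hl => ((hp (x + 1) hx).2 l (Or.inl hl) (hrb l hl _ hx)).1
  obtain ⟨M, hM⟩ : Odd (3 * k) := by rw [Nat.odd_mul]; exact ⟨by decide, hodd⟩
  have hbound := length_le_of_levels (m := m) (D := M + 1) (s := 2 * k) (lev := lev) (slabIdx := a)
    (by lia) (fun x hx => (hstep x hx).1)
    (fun x _ => by rw [hlev]; simp only; rw [hM]; exact level_le (by lia) _) ha
    (fun x hx h1 h2 => (hstep x hx).2 h1 h2 _ (ha x (by lia) h1) _ (ha _ hx h2)
      (hpa x (by lia) h1) (hpa _ hx h2))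
    (fun x hx y hy h1 hl hxy => by
      obtain ⟨F, hF, hF'⟩ := h.exists_common_face (hb x hx) (hb y hy) (hp x hx) (hp y hy)
        (v _).2 (v _).2 (hne _ (by lia)) (v _).2 (v _).2 (hne _ (by lia)) hl h1 (ha x hx h1)
        (hpa x hx h1) (hxy ▸ hpa y hy (hl ▸ h1))
      rcases hF with rfl | rfl <;> rcases hF' with h' | h' <;>
        have := hinjv _ (by lia) _ (by lia) h' <;> lia)
  rw [SimpleGraph.Walk.length_support]
  lia

end IsSlabArrangement

/-! ### The blue twins as tangents of a small circle -/

lemma height_add (a b : ℝ) (p : Plane) :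
    height (a + b) p = cos b * height a p - sin b * along a p := by
  unfold height along; rw [cos_add, sin_add]; ring

lemma polygonVertex_mul (k j : ℕ) (hk : 0 < k) :
    polygonVertex (3 * k) (j * k) = !₂[1 * cos (j * (2 * π / 3)), 1 * sin (j * (2 * π / 3))] := by
  have hk' : (k : ℝ) ≠ 0 := by positivity
  rw [polygonVertex_eq_polar]
  have : 2 * π * ((j * k : ℕ) : ℝ) / ((3 * k : ℕ) : ℝ) = j * (2 * π / 3) := by
    push_cast; field_simp
  rw [this]

/-- The disc of radius one half lies in the regular `3 * k`-gon, indeed in the triangle spanned by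
every `k`-th vertex. -/
lemma mem_polygon_of_norm_le {k : ℕ} (hk : 0 < k) {p : Plane} (hp : p 0 ^ 2 + p 1 ^ 2 ≤ 1 / 4) :
    p ∈ polygon (3 * k) := by
  set v : Fin 3 → Plane := fun j => polygonVertex (3 * k) (j * k) with hv
  set w : Fin 3 → ℝ := fun j => 1 / 3 + 2 / 3 * along (j * (2 * π / 3)) p with hw
  have c1 : cos (2 * π / 3) = -(1 / 2) := by
    rw [show 2 * π / 3 = π - π / 3 by ring, cos_pi_sub, cos_pi_div_three]
  have s1 : sin (2 * π / 3) = √3 / 2 := by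
    rw [show 2 * π / 3 = π - π / 3 by ring, sin_pi_sub, sin_pi_div_three]
  have c2 : cos (2 * (2 * π / 3)) = -(1 / 2) := by
    rw [show 2 * (2 * π / 3) = π / 3 + π by ring, cos_add_pi, cos_pi_div_three]
  have s2 : sin (2 * (2 * π / 3)) = -(√3 / 2) := by
    rw [show 2 * (2 * π / 3) = π / 3 + π by ring, sin_add_pi, sin_pi_div_three]
  have h3 : √3 * √3 = 3 := mul_self_sqrt (by norm_num)
  have hw0 : ∀ j ∈ Finset.univ, 0 ≤ w j := by
    intro j _
    have := along_sq_add_height_sq (j * (2 * π / 3)) p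
    have h4 : -(1 / 2) ≤ along (j * (2 * π / 3)) p := by
      nlinarith [sq_nonneg (height (j * (2 * π / 3)) p)]
    simp only [hw]; linarith
  have hw1 : ∑ j, w j = 1 := by
    simp only [hw, along, Fin.sum_univ_three, Fin.val_zero, Fin.val_one, Fin.val_two]
    push_cast
    rw [one_mul, c1, s1, c2, s2]
    simp; ring
  have hsum := (convex_convexHull ℝ (Set.range (polygonVertex (3 * k)))).sum_mem hw0 hw1
    (z := v) fun j _ => subset_convexHull ℝ _ ⟨_, rfl⟩
  suffices ∑ j, w j • v j = p by rwa [this] at hsum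
  simp only [hv, hw, polygonVertex_mul _ _ hk, along, Fin.sum_univ_three, Fin.val_zero,
    Fin.val_one, Fin.val_two]
  push_cast
  simp only [one_mul, c1, s1, c2, s2]
  apply plane_ext
  · simp; ring
  · simp; linear_combination (p 1 / 3) * h3

/-- A point at distance at least one half from the origin, on a tangent to the circle of radius
`sin δ / 4`, is seen from the origin at an angle less than `δ` from the tangent direction. -/
lemma exists_polar_of_mem_tangent {φ δ : ℝ} (hδ : 0 < δ) (hδ' : δ ≤ π / 2) {p : Plane}
    (hp : height φ p = sin δ / 4) (hnorm : 1 / 4 ≤ p 0 ^ 2 + p 1 ^ 2) :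
    ∃ r θ, 0 < r ∧ p = !₂[r * cos θ, r * sin θ] ∧
      ((φ < θ ∧ θ < φ + δ) ∨ (φ + π - δ < θ ∧ θ < φ + π)) := by
  set a := Complex.arg ⟨along φ p, height φ p⟩ with ha
  set r := ‖(⟨along φ p, height φ p⟩ : ℂ)‖ with hr
  have e0 : r * cos a = along φ p := Complex.norm_mul_cos_arg ⟨along φ p, height φ p⟩
  have e1 : r * sin a = height φ p := Complex.norm_mul_sin_arg ⟨along φ p, height φ p⟩
  have hr0 : 0 ≤ r := norm_nonneg _
  have hsd : 0 < sin δ := sin_pos_of_pos_of_lt_pi hδ (by linarith [pi_pos])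
  have hr2 : 1 / 4 ≤ r ^ 2 := by
    have := along_sq_add_height_sq φ p
    rw [← e0, ← e1] at this
    nlinarith [sin_sq_add_cos_sq a]
  have hr1 : 1 / 2 ≤ r := by nlinarith
  have hsa : 0 < sin a := by
    by_contra! hn
    nlinarith
  have hsa' : sin a < sin δ := by
    by_contra! hn
    nlinarith
  have ha0 : 0 < a := by
    by_contra! hn
    exact not_lt.mpr (sin_nonpos_of_nonpos_of_neg_pi_le hn (Complex.neg_pi_lt_arg _).le) hsa
  have haπ : a < π := by
    refine lt_of_le_of_ne (Complex.arg_le_pi _) fun h => ?_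
    rw [h, sin_pi] at hsa; exact lt_irrefl _ hsa
  refine ⟨r, a + φ, by linarith, ?_, ?_⟩
  · apply plane_ext
    · rw [coord_zero φ p, ← e0, ← e1, cos_add]; simp; ring
    · rw [coord_one φ p, ← e0, ← e1, sin_add]; simp; ring
  · rcases le_total a (π / 2) with h | h
    · left
      refine ⟨by linarith, ?_⟩
      by_contra! hn
      exact not_le.mpr hsa' (sin_le_sin_of_le_of_le_pi_div_two (by linarith) h (by linarith))
    · right
      refine ⟨?_, by linarith⟩
      by_contra! hn
      rw [← sin_pi_sub a] at hsa'
      exact not_le.mpr hsa' (sin_le_sin_of_le_of_le_pi_div_two (by linarith) (by linarith)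
        (by linarith))

/-- The direction angles of the `j`-th pair of twins: they deviate by `δ` to either side from the
bisector of the slab `3 * j`. -/
noncomputable def twinAngle (k : ℕ) (δ : ℝ) (j : ℕ) (s : Fin 2) : ℝ :=
  (3 * j + 1 / 2) * π / (3 * k : ℕ) + if s = 0 then δ else -δ

/-- The twins of the `j`-th pair. All twins touch one small circle about the origin, so no three of
them are concurrent. -/
noncomputable def twinLine (k : ℕ) (δ : ℝ) (j : ℕ) (s : Fin 2) : AffineSubspace ℝ Plane :=
  lineAt (twinAngle k δ j s) (sin δ / 4)

section Twins

variable {k : ℕ} {δ : ℝ} {p : Plane}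

lemma exists_polar_of_mem_twinLine (hk : 0 < k) (hδ : 0 < δ) (hδk : δ ≤ π / (8 * (3 * k : ℕ)))
    {j : ℕ} {s : Fin 2} (hp : p ∈ twinLine k δ j s) (hnorm : 1 / 4 ≤ p 0 ^ 2 + p 1 ^ 2) :
    ∃ r θ, 0 < r ∧ p = !₂[r * cos θ, r * sin θ] ∧
      ((((3 * j : ℕ) : ℝ) * π / (3 * k : ℕ) < θ ∧
        θ < (((3 * j : ℕ) : ℝ) + 1) * π / (3 * k : ℕ)) ∨
      (((3 * j + 3 * k : ℕ) : ℝ) * π / (3 * k : ℕ) < θ ∧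
        θ < (((3 * j + 3 * k : ℕ) : ℝ) + 1) * π / (3 * k : ℕ))) := by
  have hk' : (1 : ℝ) ≤ k := by exact_mod_cast hk
  set u := π / (3 * k : ℕ) with hu
  have hN : (0 : ℝ) < (3 * k : ℕ) := by push_cast; linarith
  have hu0 : 0 < u := div_pos pi_pos hN
  have hNu : (3 * k : ℕ) * u = π := by rw [hu]; field_simp
  have hδu : δ ≤ u / 8 := by
    convert hδk using 1; rw [hu]; field_simp
  have huπ : u ≤ π := by
    rw [← hNu]; push_cast; nlinarith
  obtain ⟨r, θ, hr, hpp, hθ⟩ := exists_polar_of_mem_tangent hδ (by linarith) (mem_lineAt.mp hp) hnorm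
  refine ⟨r, θ, hr, hpp, ?_⟩
  have hφ : twinAngle k δ j s = 3 * j * u + u / 2 + if s = 0 then δ else -δ := by
    rw [twinAngle, hu]; ring
  have b1 : 3 * j * u + u / 2 - δ ≤ twinAngle k δ j s := by rw [hφ]; split_ifs <;> linarith
  have b2 : twinAngle k δ j s ≤ 3 * j * u + u / 2 + δ := by rw [hφ]; split_ifs <;> linarith
  have e1 : ((3 * j : ℕ) : ℝ) * π / (3 * k : ℕ) = 3 * j * u := by rw [hu]; push_cast; ring
  have e2 : (((3 * j : ℕ) : ℝ) + 1) * π / (3 * k : ℕ) = 3 * j * u + u := by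
    rw [hu]; push_cast; ring
  have e3 : ((3 * j + 3 * k : ℕ) : ℝ) * π / (3 * k : ℕ) = 3 * j * u + π := by
    rw [mul_div_assoc, ← hu]; push_cast at hNu ⊢; linear_combination hNu
  have e4 : (((3 * j + 3 * k : ℕ) : ℝ) + 1) * π / (3 * k : ℕ) = 3 * j * u + u + π := by
    rw [mul_div_assoc, ← hu]; push_cast at hNu ⊢; linear_combination hNu
  rw [e1, e2, e3, e4]
  rcases hθ with ⟨h1, h2⟩ | ⟨h1, h2⟩
  · left; constructor <;> linarith
  · right; constructor <;> linarith

lemma liesInMarkedSlabs_twinLine (hk : 0 < k) (hδ : 0 < δ) (hδk : δ ≤ π / (8 * (3 * k : ℕ)))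
    (j : ℕ) (s : Fin 2) : LiesInMarkedSlabs k j (twinLine k δ j s) := by
  rintro p ⟨hp, hpP⟩
  have hnorm : 1 / 4 ≤ p 0 ^ 2 + p 1 ^ 2 := by
    by_contra! hn
    exact hpP (mem_polygon_of_norm_le hk hn.le)
  obtain ⟨r, θ, hr, hpp, hθ⟩ := exists_polar_of_mem_twinLine hk hδ hδk hp hnorm
  rcases hθ with ⟨h1, h2⟩ | ⟨h1, h2⟩
  · exact Or.inl ⟨⟨r, θ, hr, h1, h2, hpp⟩, hpP⟩
  · exact Or.inr ⟨⟨r, θ, hr, h1, h2, hpp⟩, hpP⟩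

lemma exists_wedge_of_mem_twinLine (hk : 0 < k) (hδ : 0 < δ) (hδk : δ ≤ π / (8 * (3 * k : ℕ)))
    {j : ℕ} {s : Fin 2} (hp : p ∈ twinLine k δ j s) (hnorm : 1 / 4 ≤ p 0 ^ 2 + p 1 ^ 2) :
    p ∈ wedge (3 * k) (3 * j : ℕ) ∨ p ∈ wedge (3 * k) (3 * j + 3 * k : ℕ) := by
  obtain ⟨r, θ, hr, rfl, hθ⟩ := exists_polar_of_mem_twinLine hk hδ hδk hp hnorm
  rcases hθ with ⟨h1, h2⟩ | ⟨h1, h2⟩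
  · exact Or.inl (mem_wedge_of_polar (by lia) hr (by exact_mod_cast h1) (by exact_mod_cast h2))
  · exact Or.inr (mem_wedge_of_polar (by lia) hr (by exact_mod_cast h1) (by exact_mod_cast h2))

lemma norm_lt_of_mem_twins (hδ : 0 < δ) (hδ' : δ ≤ π / 3) {j : ℕ}
    (h0 : p ∈ twinLine k δ j 0) (h1 : p ∈ twinLine k δ j 1) : p 0 ^ 2 + p 1 ^ 2 < 1 / 4 := by
  have hs : 0 < sin δ := sin_pos_of_pos_of_lt_pi hδ (by linarith [pi_pos])
  have hc : 1 / 2 ≤ cos δ := by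
    rw [← cos_pi_div_three]
    exact cos_le_cos_of_nonneg_of_le_pi hδ.le (by linarith [pi_pos]) hδ'
  rw [twinLine, mem_lineAt, twinAngle, height_add] at h0 h1
  simp only [if_true, one_ne_zero, if_false, cos_neg, sin_neg] at h0 h1
  set α := (3 * (j : ℝ) + 1 / 2) * π / (3 * k : ℕ)
  have ha : along α p = 0 := by
    have : sin δ * along α p = 0 := by linarith
    exact (mul_eq_zero.mp this).resolve_left hs.ne'
  rw [ha] at h0
  have hh : cos δ * height α p = sin δ / 4 := by linarith
  have h2 := sin_sq_add_cos_sq δ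
  have h3 : (cos δ * height α p) ^ 2 = (sin δ / 4) ^ 2 := by rw [hh]
  rw [← along_sq_add_height_sq α p, ha]
  nlinarith [mul_nonneg (sq_nonneg (height α p)) (show 0 ≤ cos δ ^ 2 - 1 / 4 by nlinarith)]

lemma sin_twinAngle_sub_ne_zero (hk : 0 < k) (hδ : 0 < δ) (hδk : δ ≤ π / (8 * (3 * k : ℕ)))
    {i j : ℕ} (hi : i < k) (hj : j < k) {s s' : Fin 2} (hne : ¬ (i = j ∧ s = s')) :
    sin (twinAngle k δ i s - twinAngle k δ j s') ≠ 0 := by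
  intro h
  obtain ⟨n, hn⟩ := sin_eq_zero_iff.mp h
  have hk' : (1 : ℝ) ≤ k := by exact_mod_cast hk
  set d : ℝ := (if s = 0 then δ else -δ) - (if s' = 0 then δ else -δ) with hd
  have hδk' : 24 * (k * δ) ≤ π := by
    rw [le_div_iff₀ (by push_cast; linarith)] at hδk; push_cast at hδk; linarith
  have hkδ : 0 < k * δ := by positivity
  have e : ((n * k - (i - j) : ℤ) : ℝ) * π = k * d := by
    have : twinAngle k δ i s - twinAngle k δ j s' = (i - j) * π / k + d := by
      rw [twinAngle, twinAngle, hd]; push_cast; field_simp; ring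
    rw [this] at hn
    push_cast
    field_simp at hn
    linear_combination hn
  have hd1 : k * d ≤ 2 * (k * δ) := by rw [hd]; split_ifs <;> linarith
  have hd2 : -(2 * (k * δ)) ≤ k * d := by rw [hd]; split_ifs <;> linarith
  have hz : n * k - ((i : ℤ) - j) = 0 := by
    set z : ℤ := n * k - ((i : ℤ) - j)
    have z1 : (z : ℝ) < 1 := by
      by_contra! hc; nlinarith [pi_pos]
    have z2 : (-1 : ℝ) < z := by
      by_contra! hc; nlinarith [pi_pos]
    have : z < 1 := by exact_mod_cast z1
    have : -1 < z := by exact_mod_cast z2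
    lia
  rw [hz, Int.cast_zero, zero_mul, eq_comm, mul_eq_zero] at e
  have hd0 : d = 0 := e.resolve_left (by positivity)
  have hn0 : n = 0 := by
    by_contra hn0
    rcases lt_or_gt_of_ne hn0 with h1 | h1 <;> nlinarith
  refine hne ⟨?_, ?_⟩
  · rw [hn0] at hz; lia
  · rw [hd] at hd0
    split_ifs at hd0 with h1 h2 h2
    · rw [h1, h2]
    · linarith
    · linarith
    · lia

/-- The bisector of a slab is parallel to a side line, but the twins deviate from it. -/
lemma sin_twinAngle_sub_side_ne_zero (hk : Odd k) (hδ : 0 < δ)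
    (hδk : δ ≤ π / (8 * (3 * k : ℕ))) (i j : ℕ) (s : Fin 2) :
    sin (twinAngle k δ j s - ((2 * i + 1) * π / (3 * k : ℕ) - π / 2)) ≠ 0 := by
  intro h
  obtain ⟨n, hn⟩ := sin_eq_zero_iff.mp h
  obtain ⟨M, hM⟩ : Odd (3 * k) := by rw [Nat.odd_mul]; exact ⟨by decide, hk⟩
  have hk' : (1 : ℝ) ≤ k := by exact_mod_cast hk.pos
  have hM' : (3 : ℝ) * k = 2 * M + 1 := by exact_mod_cast hM
  set d : ℝ := if s = 0 then δ else -δ with hd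
  have hδk' : 24 * (k * δ) ≤ π := by
    rw [le_div_iff₀ (by push_cast; linarith)] at hδk; push_cast at hδk; linarith
  have hkδ : 0 < k * δ := by positivity
  have e : ((n * (3 * k) - (3 * j - 2 * i + M) : ℤ) : ℝ) * π = 3 * (k * d) := by
    have : twinAngle k δ j s - ((2 * i + 1) * π / (3 * k : ℕ) - π / 2) =
        (3 * j - 2 * i + M) * π / (3 * k) + d := by
      have : (M : ℝ) = (3 * k - 1) / 2 := by linarith
      rw [twinAngle, ← hd, this]; push_cast; field_simp; ring
    rw [this] at hn
    push_cast
    field_simp at hn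
    linear_combination hn
  set z : ℤ := n * (3 * k) - (3 * j - 2 * i + M)
  have hd1 : k * d ≤ k * δ := by rw [hd]; split_ifs <;> linarith
  have hd2 : -(k * δ) ≤ k * d := by rw [hd]; split_ifs <;> linarith
  have hd0 : k * d ≠ 0 := by
    rw [hd]; split_ifs
    · exact hkδ.ne'
    · rw [mul_neg]; exact neg_ne_zero.mpr hkδ.ne'
  have z1 : (z : ℝ) < 1 := by
    by_contra! hc; nlinarith [pi_pos]
  have z2 : (-1 : ℝ) < z := by
    by_contra! hc; nlinarith [pi_pos]
  have z1' : z < 1 := by exact_mod_cast z1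
  have z2' : -1 < z := by exact_mod_cast z2
  have hz : z = 0 := by lia
  rw [hz, Int.cast_zero, zero_mul] at e
  exact hd0 (by linarith)

lemma twinLine_inj (hk : 0 < k) (hδ : 0 < δ) (hδk : δ ≤ π / (8 * (3 * k : ℕ)))
    {i j : ℕ} (hi : i < k) (hj : j < k) {s s' : Fin 2}
    (h : twinLine k δ i s = twinLine k δ j s') : i = j ∧ s = s' := by
  by_contra hne
  refine sin_twinAngle_sub_ne_zero hk hδ hδk hi hj hne
    (sin_sub_eq_zero_of_parallel (c := sin δ / 4) (d := sin δ / 4) ?_)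
  unfold twinLine at h
  rw [h]

lemma nearlyParallel_twinLine (hδ : 0 < δ) (hδ' : δ ≤ π / 2) {ε : ℝ} (hε : 2 * δ < ε) (j : ℕ) :
    NearlyParallel ε (twinLine k δ j 0) (twinLine k δ j 1) := by
  have norm1 : ∀ a : ℝ, ‖(!₂[cos a, sin a] : Plane)‖ = 1 := fun a => by
    rw [EuclideanSpace.norm_eq]; simp
  have ne0 : ∀ a : ℝ, (!₂[cos a, sin a] : Plane) ≠ 0 := fun a h => by
    have := norm1 a; rw [h, norm_zero] at this; exact zero_ne_one this
  refine ⟨!₂[cos (twinAngle k δ j 0), sin (twinAngle k δ j 0)], ?_,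
    !₂[cos (twinAngle k δ j 1), sin (twinAngle k δ j 1)], ?_, ne0 _, ne0 _, ?_⟩
  · rw [twinLine, direction_lineAt]; exact Submodule.mem_span_singleton_self _
  · rw [twinLine, direction_lineAt]; exact Submodule.mem_span_singleton_self _
  · rw [InnerProductGeometry.angle, norm1, norm1]
    have : inner ℝ (!₂[cos (twinAngle k δ j 0), sin (twinAngle k δ j 0)] : Plane)
        !₂[cos (twinAngle k δ j 1), sin (twinAngle k δ j 1)] = cos (2 * δ) := by
      rw [show 2 * δ = twinAngle k δ j 0 - twinAngle k δ j 1 by simp [twinAngle]; ring, cos_sub]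
      simp [PiLp.inner_apply, Fin.sum_univ_two]; ring
    rw [this, mul_one, div_one, arccos_cos (by linarith) (by linarith)]
    exact hε

lemma norm_ge_of_mem_sideLine {N : ℕ} (hN : 3 ≤ N) {i : ℕ} (hp : p ∈ sideLine N i) :
    1 / 4 ≤ p 0 ^ 2 + p 1 ^ 2 := by
  have hN' : (3 : ℝ) ≤ N := by exact_mod_cast hN
  rw [mem_sideLine_iff hN] at hp
  have hc : 1 / 2 ≤ cos (π / N) := by
    rw [← cos_pi_div_three]
    refine cos_le_cos_of_nonneg_of_le_pi (by positivity) (by linarith [pi_pos]) ?_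
    exact div_le_div_of_nonneg_left pi_pos.le (by norm_num) hN'
  rw [← along_sq_add_height_sq ((2 * i + 1) * π / N - π / 2) p, hp]
  nlinarith [sq_nonneg (along ((2 * i + 1) * π / N - π / 2) p)]

/-- Two side lines cross on an axis of symmetry, which the twins avoid outside the polygon. -/
lemma not_two_sides_one_twin (hk : 0 < k) (hδ : 0 < δ) (hδk : δ ≤ π / (8 * (3 * k : ℕ)))
    {a b j : ℕ} {s : Fin 2} (ha : a < 3 * k) (hb : b < 3 * k) (hab : a ≠ b)
    (hpa : p ∈ sideLine (3 * k) a) (hpb : p ∈ sideLine (3 * k) b) (hp : p ∈ twinLine k δ j s) :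
    False := by
  have hN : 3 ≤ 3 * k := by lia
  have key : ∀ {a b : ℕ}, b < a → a < 3 * k → p ∈ sideLine (3 * k) a → p ∈ sideLine (3 * k) b →
      False := by
    intro a b hba ha hpa hpb
    obtain ⟨m, hm⟩ : ∃ m, p ∈ wedge (3 * k) m :=
      (exists_wedge_of_mem_twinLine hk hδ hδk hp (norm_ge_of_mem_sideLine hN hpa)).elim
        (fun h => ⟨_, h⟩) (fun h => ⟨_, h⟩)
    rw [mem_sideLine_iff hN, height_sub_pi_div_two, ← sub_eq_zero] at hpa hpb
    have h := sideDist_sub_sideDist (3 * k) a b p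
    have hs := sin_mul_pi_div_pos (N := 3 * k) (d := (a : ℤ) - b) (by lia) (by lia)
    have hax := axis_mul_pos_of_mem_wedge (by lia) hm hm (a + b + 1)
    push_cast at hs h
    unfold sideDist at h
    push_cast at hpa hpb h
    rw [hpa, hpb, sub_self, eq_comm, mul_eq_zero] at h
    rcases h with h | h
    · linarith
    · rw [h, mul_zero] at hax; exact lt_irrefl _ hax
  rcases lt_or_gt_of_ne hab with h | h
  · exact key h hb hpb hpa
  · exact key h ha hpa hpb

/-- Blue lines do not cross on a side line: blue lines that are not twins have no slab in common,
and twins cross close to the origin. -/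
lemma not_one_side_two_twins (hk : 0 < k) (hδ : 0 < δ) (hδk : δ ≤ π / (8 * (3 * k : ℕ)))
    {a i j : ℕ} {s s' : Fin 2} (hi : i < k) (hj : j < k) (hne : ¬ (i = j ∧ s = s'))
    (hpa : p ∈ sideLine (3 * k) a) (hpi : p ∈ twinLine k δ i s) (hpj : p ∈ twinLine k δ j s') :
    False := by
  have hk' : (1 : ℝ) ≤ k := by exact_mod_cast hk
  have hnorm := norm_ge_of_mem_sideLine (by lia) hpa
  have hij : i = j := by
    rcases exists_wedge_of_mem_twinLine hk hδ hδk hpi hnorm with h | h <;>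
    rcases exists_wedge_of_mem_twinLine hk hδ hδk hpj hnorm with h' | h' <;>
    · have := eq_of_mem_wedge (by lia) (by lia) (by lia) (by lia) h h'
      lia
  subst hij
  have hδ' : δ ≤ π / 3 := hδk.trans
    (div_le_div_of_nonneg_left pi_pos.le (by norm_num) (by push_cast; linarith))
  have hss : s ≠ s' := fun h => hne ⟨rfl, h⟩
  obtain ⟨rfl, rfl⟩ | ⟨rfl, rfl⟩ : (s = 0 ∧ s' = 1) ∨ (s = 1 ∧ s' = 0) := by lia
  · exact not_lt.mpr hnorm (norm_lt_of_mem_twins hδ hδ' hpi hpj)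
  · exact not_lt.mpr hnorm (norm_lt_of_mem_twins hδ hδ' hpj hpi)

end Twins

lemma encard_le_two_of_forall {α : Type*} {s : Set α}
    (h : ∀ x ∈ s, ∀ y ∈ s, ∀ z ∈ s, x ≠ y → x ≠ z → y ≠ z → False) : s.encard ≤ 2 := by
  by_contra! hn
  have h3 : (3 : ℕ∞) ≤ s.encard := Order.add_one_le_of_lt hn
  obtain ⟨t, hts, ht⟩ := Set.exists_subset_encard_eq h3
  obtain ⟨x, y, z, hxy, hxz, hyz, rfl⟩ := Set.encard_eq_three.mp ht
  exact h x (hts (by simp)) y (hts (by simp)) z (hts (by simp)) hxy hxz hyz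

/-- The construction: the side lines of the regular `3 * k`-gon and the twins are in general
position. -/
theorem exists_isSlabArrangement {k : ℕ} (hk : Odd k) {δ : ℝ} (hδ : 0 < δ)
    (hδk : δ ≤ π / (8 * (3 * k : ℕ))) :
    ∃ A : BicoloredArrangement, IsSimple A.lines ∧ A.red.card = 3 * k ∧ A.blue.card = 2 * k ∧
      IsSlabArrangement k A fun j s => twinLine k δ j s := by
  classical
  have hk0 := hk.pos
  have hN : 3 ≤ 3 * k := by lia
  have hodd : Odd (3 * k) := by rw [Nat.odd_mul]; exact ⟨by decide, hk⟩
  have hk' : (1 : ℝ) ≤ k := by exact_mod_cast hk0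
  have hδ' : δ ≤ π / 3 := hδk.trans
    (div_le_div_of_nonneg_left pi_pos.le (by norm_num) (by push_cast; linarith))
  have hsd : 0 < sin δ := sin_pos_of_pos_of_lt_pi hδ (by linarith [pi_pos])
  have hcos : 0 < cos (π / (3 * k : ℕ)) := cos_pos_of_mem_Ioo
    ⟨by have : 0 < π / (3 * k : ℕ) := by positivity
        linarith [pi_pos],
      div_lt_div_of_pos_left pi_pos (by norm_num) (by push_cast; linarith)⟩
  have nosame : ∀ (i j : ℕ) (s : Fin 2), ¬ (twinLine k δ j s).Parallel (sideLine (3 * k) i) := by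
    intro i j s h
    rw [sideLine_eq_lineAt hN] at h
    exact sin_twinAngle_sub_side_ne_zero hk hδ hδk i j s (sin_sub_eq_zero_of_parallel h)
  set red := (Finset.range (3 * k)).image (sideLine (3 * k)) with hred
  set blue := (Finset.univ : Finset (Fin k × Fin 2)).image fun x => twinLine k δ x.1 x.2 with hblue
  have mred : ∀ l, l ∈ red ↔ ∃ i < 3 * k, l = sideLine (3 * k) i := by
    intro l; simp [hred, eq_comm]
  have mblue : ∀ l, l ∈ blue ↔ ∃ (j : Fin k) (s : Fin 2), l = twinLine k δ j s := by
    intro l; simp [hblue, eq_comm]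
  have hdisj : Disjoint red blue := by
    rw [Finset.disjoint_left]
    intro l h1 h2
    obtain ⟨i, -, rfl⟩ := (mred l).mp h1
    obtain ⟨j, s, h⟩ := (mblue _).mp h2
    exact nosame i j s (by rw [h])
  refine ⟨⟨red, blue, ?_, ?_, hdisj, ?_, ?_⟩, ⟨?_, ?_⟩, ?_, ?_, ⟨mred, mblue, ?_, ?_⟩⟩
  · intro l hl
    obtain ⟨i, -, rfl⟩ := (mred l).mp hl
    rw [sideLine_eq_lineAt hN]; exact isLine_lineAt _ _
  · intro l hl
    obtain ⟨j, s, rfl⟩ := (mblue l).mp hl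
    exact isLine_lineAt _ _
  · exact ⟨_, (mred _).mpr ⟨0, by lia, rfl⟩⟩
  · exact ⟨_, (mblue _).mpr ⟨⟨0, hk0⟩, 0, rfl⟩⟩
  · rintro l (hl | hl) m (hm | hm) hlm hpar
    · obtain ⟨i, hi, rfl⟩ := (mred l).mp hl
      obtain ⟨j, hj, rfl⟩ := (mred m).mp hm
      rw [sideLine_eq_lineAt hN, sideLine_eq_lineAt hN] at hpar
      exact hlm (by rw [eq_of_sin_sub_eq_zero hodd hi hj (sin_sub_eq_zero_of_parallel hpar)])
    · obtain ⟨i, hi, rfl⟩ := (mred l).mp hl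
      obtain ⟨j, s, rfl⟩ := (mblue m).mp hm
      exact nosame i j s hpar.symm
    · obtain ⟨j, s, rfl⟩ := (mblue l).mp hl
      obtain ⟨i, hi, rfl⟩ := (mred m).mp hm
      exact nosame i j s hpar
    · obtain ⟨i, s, rfl⟩ := (mblue l).mp hl
      obtain ⟨j, s', rfl⟩ := (mblue m).mp hm
      refine sin_twinAngle_sub_ne_zero hk0 hδ hδk i.isLt j.isLt (s := s) (s' := s') ?_
        (sin_sub_eq_zero_of_parallel hpar)
      rintro ⟨h1, rfl⟩
      exact hlm (by rw [h1])
  · intro p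
    have rrb : ∀ l ∈ red, ∀ m ∈ red, ∀ b ∈ blue, l ≠ m → p ∈ l → p ∈ m → p ∈ b → False := by
      intro l hl m hm b hb hlm hpl hpm hpb
      obtain ⟨i, hi, rfl⟩ := (mred l).mp hl
      obtain ⟨j, hj, rfl⟩ := (mred m).mp hm
      obtain ⟨j', s, rfl⟩ := (mblue b).mp hb
      exact not_two_sides_one_twin hk0 hδ hδk hi hj (fun h => hlm (by rw [h])) hpl hpm hpb
    have rbb : ∀ l ∈ red, ∀ b ∈ blue, ∀ c ∈ blue, b ≠ c → p ∈ l → p ∈ b → p ∈ c → False := by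
      intro l hl b hb c hc hbc hpl hpb hpc
      obtain ⟨a, ha, rfl⟩ := (mred l).mp hl
      obtain ⟨i, s, rfl⟩ := (mblue b).mp hb
      obtain ⟨j, s', rfl⟩ := (mblue c).mp hc
      exact not_one_side_two_twins hk0 hδ hδk i.isLt j.isLt
        (fun h => hbc (by rw [h.1, h.2])) hpl hpb hpc
    refine encard_le_two_of_forall ?_
    rintro x ⟨hx, hpx⟩ y ⟨hy, hpy⟩ z ⟨hz, hpz⟩ hxy hxz hyz
    rcases hx with hx | hx <;> rcases hy with hy | hy <;> rcases hz with hz | hz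
    · obtain ⟨a, ha, rfl⟩ := (mred x).mp hx
      obtain ⟨b, hb, rfl⟩ := (mred y).mp hy
      obtain ⟨c, hc, rfl⟩ := (mred z).mp hz
      rw [mem_sideLine_iff hN] at hpx hpy hpz
      refine not_three_tangents hcos.ne' ?_ ?_ ?_ hpx hpy hpz <;> intro h
      · exact hxy (by rw [eq_of_sin_sub_eq_zero hodd ha hb h])
      · exact hxz (by rw [eq_of_sin_sub_eq_zero hodd ha hc h])
      · exact hyz (by rw [eq_of_sin_sub_eq_zero hodd hb hc h])
    · exact rrb x hx y hy z hz hxy hpx hpy hpz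
    · exact rrb x hx z hz y hy hxz hpx hpz hpy
    · exact rbb x hx y hy z hz hyz hpx hpy hpz
    · exact rrb y hy z hz x hx hyz hpy hpz hpx
    · exact rbb y hy x hx z hz hxz hpy hpx hpz
    · exact rbb z hz x hx y hy hxy hpz hpx hpy
    · obtain ⟨a, s, rfl⟩ := (mblue x).mp hx
      obtain ⟨b, s', rfl⟩ := (mblue y).mp hy
      obtain ⟨c, s'', rfl⟩ := (mblue z).mp hz
      have hne : ∀ {a b : Fin k} {s s' : Fin 2}, twinLine k δ a s ≠ twinLine k δ b s' →
          sin (twinAngle k δ a s - twinAngle k δ b s') ≠ 0 := fun {a b s s'} h =>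
        sin_twinAngle_sub_ne_zero hk0 hδ hδk a.isLt b.isLt fun h' => h (by rw [h'.1, h'.2])
      exact not_three_tangents (by positivity) (hne hxy) (hne hxz) (hne hyz)
        (mem_lineAt.mp hpx) (mem_lineAt.mp hpy) (mem_lineAt.mp hpz)
  · show red.card = 3 * k
    rw [hred, Finset.card_image_of_injOn, Finset.card_range]
    intro i hi j hj h
    exact sideLine_injective hN hodd (Finset.mem_range.mp hi) (Finset.mem_range.mp hj) h
  · show blue.card = 2 * k
    rw [hblue, Finset.card_image_of_injective, Finset.card_univ, Fintype.card_prod, Fintype.card_fin,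
      Fintype.card_fin, mul_comm]
    rintro ⟨i, s⟩ ⟨j, s'⟩ h
    obtain ⟨h1, h2⟩ := twinLine_inj hk0 hδ hδk i.isLt j.isLt h
    exact Prod.ext (Fin.ext h1) h2
  · exact fun j s => liesInMarkedSlabs_twinLine hk0 hδ hδk j s
  · exact fun j p h0 h1 => mem_polygon_of_norm_le hk0 (norm_lt_of_mem_twins hδ hδ' h0 h1).le

end LineArr

theorem theorem2 (k : ℕ) (hk : Odd k) (ε : ℝ) (hε : 0 < ε) :
    ∃ A : LineArr.BicoloredArrangement,
      LineArr.IsSimple A.lines ∧ A.red.card = 3 * k ∧ A.blue.card = 2 * k ∧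
      -- every alternating dual path visits at most `14 k` faces
      (∀ (f g : LineArr.Face A.lines) (p : (LineArr.dualGraph A.lines).Walk f g),
        p.IsPath → A.IsAlternating p → p.support.length ≤ 14 * k) ∧
      -- the red lines extend the sides of a regular `3 k`-gon
      (∀ l, l ∈ A.red ↔ ∃ i < 3 * k, l = LineArr.sideLine (3 * k) i) ∧
      -- the blue lines are `k` twin pairs, one for each pair of opposite marked slabs
      (∃ t : Fin k → Fin 2 → AffineSubspace ℝ LineArr.Plane,
        (∀ l, l ∈ A.blue ↔ ∃ j b, l = t j b) ∧
        ∀ j, LineArr.NearlyParallel ε (t j 0) (t j 1) ∧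
          ∀ b, LineArr.LiesInMarkedSlabs k j (t j b)) := by
  have hk' : (1 : ℝ) ≤ k := by exact_mod_cast hk.pos
  set δ := min (ε / 4) (Real.pi / (8 * (3 * k : ℕ))) with hδ
  have hδ0 : 0 < δ := lt_min (by linarith) (div_pos Real.pi_pos (by push_cast; linarith))
  have hδε : δ ≤ ε / 4 := min_le_left _ _
  have hδk : δ ≤ Real.pi / (8 * (3 * k : ℕ)) := min_le_right _ _
  have hδ' : δ ≤ Real.pi / 2 := hδk.trans
    (div_le_div_of_nonneg_left Real.pi_pos.le (by norm_num) (by push_cast; linarith))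
  obtain ⟨A, hsimple, hr, hb, hA⟩ := LineArr.exists_isSlabArrangement hk hδ0 hδk
  exact ⟨A, hsimple, hr, hb, fun f g p hp halt => hA.alternating_path_length_le hk p hp halt,
    hA.mem_red, _, hA.mem_blue, fun j =>
      ⟨LineArr.nearlyParallel_twinLine hδ0 hδ' (by linarith) j, fun b => hA.slabs j b⟩⟩
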